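/- Let $n,m,K\ge 0$ be integers and let $\Lambda^K B_{n,m}$ be the set of $n\times m$ matrices with entries in $\{0,1\}$ and exactly $K$ ones. *Crystals.* For $k\ge 0$ let $\mathcal E_k=\bigsqcup_j \mathcal B^{\mathfrak{gl}_k}_{\varpi_j}$ be the $\mathfrak{gl}_k$-crystal of all $c\in\{0,1\}^k$, with $\mathrm{wt}(c)=c\in\mathbb Z^k$, where for $1\le i\le k-1$ the operator $e_i$ replaces $(c_i,c_{i+1})=(0,1)$ by $(1,0)$ and is $0$ otherwise, $f_i$ replaces $(1,0)$ by $(0,1)$ and is $0$ otherwise, and $\epsilon_i(c)$, $\phi_i(c)$ equal $1$ or $0$ according to whether $e_i(c)\neq 0$, $f_i(c)\ne0$. Write $\langle\mu,\alpha_i^\vee\rangle=\mu_i-\mu_{i+1}$. On a tensor product, $\mathrm{wt}(b_1\otimes\cdots\otimes b_r)=\sum_j\mathrm{wt}(b_j)$, and with $\epsilon_i^s=\epsilon_i(b_s)-\langle \sum_{j<s}\mathrm{wt}(b_j),\alpha_i^\vee\rangle$, $\phi_i^s=\phi_i(b_s)+\langle \sum_{j>s}\mathrm{wt}(b_j),\alpha_i^\vee\rangle$,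 $\epsilon_i=\max_s\{\epsilon_i^s,0\}$, $\phi_i=\max_s\{\phi_i^s,0\}$, the operator $e_i$ acts on the factor with the smallest index $s$ such that $\epsilon_i^s=\epsilon_i$ and $f_i$ acts on the factor with the largest index $t$ such that $\phi_i^t=\phi_i$. A $0/1$ matrix with rows $r_1,\dots,r_n$ is regarded as the element $r_1\otimes\cdots\otimes r_n$ of the $\mathfrak{gl}_m$-crystal $\mathcal E_m^{\otimes n}$, and a $0/1$ matrix with columns $c_1,\dots,c_m$ as the element $c_m\otimes\cdots\otimes c_1$ of the $\mathfrak{gl}_n$-crystal $\mathcal E_n^{\otimes m}$. *Schützenberger involutions.* For a $\mathfrak{gl}_k$-crystal $B$ and $1\le p<q\le k$, $\xi_{p,q}:B\to B$ is the unique map that preserves every connected component of the crystal graph restricted to the labels $\{p,\dots,q-1\}$, satisfies $e_i\,\xi_{p,q}(b)=\xi_{p,q}(f_{p+q-1-i}\,b)$ and $f_i\,\xi_{p,q}(b)=\xi_{p,q}(e_{p+q-1-i}\,b)$ for all $b\in B$ and $p\le i\le q-1$ (with $\xi_{p,q}(0)=0$), and acts on weights by reversing the coordinates $p,\dots,q$.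 Write $\xi=\xi_{1,k}$ for the involution of the whole crystal (the identity if $k\le 1$). *Cactus actions.* Let $C_m$ be the cactus group of $\mathfrak{gl}_m$, with generators $s_{p,q}$, $1\le p<q\le m$. The inner action of $s_{p,q}$ on $0/1$ matrices is $s^{\mathrm i}_{p,q}=\xi_{p,q}$ for the $\mathfrak{gl}_m$-crystal structure. The outer action of $s_{p,q}$ is defined on $m$-fold tensor products of $\mathfrak{gl}_n$-crystals by $$s^{\mathrm o}_{p,q}(b_1\otimes\cdots\otimes b_m)=b_1\otimes\cdots\otimes b_{p-1}\otimes\xi\bigl(\xi(b_q)\otimes\xi(b_{q-1})\otimes\cdots\otimes\xi(b_p)\bigr)\otimes b_{q+1}\otimes\cdots\otimes b_m,$$ and on $0/1$ matrices through $c_m\otimes\cdots\otimes c_1$. **Corollary.** Let $1\le p<q\le m$. The Schützenberger involutions that enter $s^{\mathrm i}_{p,q}$ and $s^{\mathrm o}_{m+1-q,m+1-p}$ exist and are unique, and for every $N\in\Lambda^K B_{n,m}$ one has $s^{\mathrm o}_{m+1-q,\,m+1-p}(N)\in\Lambda^K B_{n,m}$ and $$s^{\mathrm o}_{m+1-q,\,m+1-p}(N)=s^{\mathrm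 i}_{p,q}(N).$$ -/

import Mathlib

/-! Positions, simple roots and tensor factors are numbered from `0`: the position `a : Fin k` is
the `(a + 1)`-st coordinate of the weight lattice `ℤ ^ k` of `gl_k`, and `i : Fin (k - 1)` is the
simple root `ε_i - ε_{i+1}` joining the positions `i` and `i + 1`. -/

/-- The maps of a `gl_k`-crystal on the set `B`; the value `none` of a Kashiwara operator is `0`. -/
structure GLCrystalData (k : ℕ) (B : Type) where
  e : Fin (k - 1) → B → Option B
  f : Fin (k - 1) → B → Option B
  eps : Fin (k - 1) → B → ℤ
  phi : Fin (k - 1) → B → ℤ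
  wt : B → Fin k → ℤ

/-- The first position of the simple root `i`. -/
def rootLo {k : ℕ} (i : Fin (k - 1)) : Fin k := ⟨i.val, by have := i.isLt; omega⟩

/-- The second position of the simple root `i`. -/
def rootHi {k : ℕ} (i : Fin (k - 1)) : Fin k := ⟨i.val + 1, by have := i.isLt; omega⟩

/-- The pairing of a weight with the simple coroot `α_i^∨`. -/
def corootPairing {k : ℕ} (i : Fin (k - 1)) (w : Fin k → ℤ) : ℤ := w (rootLo i) - w (rootHi i)

/-- The disjoint union over `j` of the crystals of the fundamental representations `Λ^j ℂ^k`: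
its elements are the `0/1`-vectors of length `k`, the `j`-th piece consisting of those with exactly
`j` ones. The operator `e_i` moves a one from position `i + 1` to position `i`, and `f_i` moves it
back, when possible. -/
def exteriorCrystal (k : ℕ) : GLCrystalData k (Fin k → Bool) where
  e i c := if c (rootLo i) = false ∧ c (rootHi i) = true then
    some (c ∘ Equiv.swap (rootLo i) (rootHi i)) else none
  f i c := if c (rootLo i) = true ∧ c (rootHi i) = false then
    some (c ∘ Equiv.swap (rootLo i) (rootHi i)) else none
  eps i c := if c (rootLo i) = false ∧ c (rootHi i) = true then 1 else 0
  phi i c := if c (rootLo i) = true ∧ c (rootHi i) = false then 1 else 0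
  wt c a := if c a = true then 1 else 0

namespace GLCrystalData

variable {k : ℕ} {B : Type}

/-- `ε_i^s (b_0 ⊗ ⋯ ⊗ b_{r-1}) = ε_i (b_s) - ⟨α_i^∨, wt b_0 + ⋯ + wt b_{s-1}⟩`. -/
def tensorEpsAt (C : GLCrystalData k B) {r : ℕ} (i : Fin (k - 1)) (b : Fin r → B)
    (s : Fin r) : ℤ :=
  C.eps i (b s) - corootPairing i (∑ j ∈ Finset.Iio s, C.wt (b j))

/-- `φ_i^s (b_0 ⊗ ⋯ ⊗ b_{r-1}) = φ_i (b_s) + ⟨α_i^∨, wt b_{s+1} + ⋯ + wt b_{r-1}⟩`. -/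
def tensorPhiAt (C : GLCrystalData k B) {r : ℕ} (i : Fin (k - 1)) (b : Fin r → B)
    (s : Fin r) : ℤ :=
  C.phi i (b s) + corootPairing i (∑ j ∈ Finset.Ioi s, C.wt (b j))

/-- `ε_i = max_s {ε_i^s, 0}`. -/
def tensorEps (C : GLCrystalData k B) {r : ℕ} (i : Fin (k - 1)) (b : Fin r → B) : ℤ :=
  Finset.univ.fold max 0 (C.tensorEpsAt i b)

/-- `φ_i = max_s {φ_i^s, 0}`. -/
def tensorPhi (C : GLCrystalData k B) {r : ℕ} (i : Fin (k - 1)) (b : Fin r → B) : ℤ :=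
  Finset.univ.fold max 0 (C.tensorPhiAt i b)

/-- The tensor power `C ⊗ ⋯ ⊗ C` with `r` factors; `b : Fin r → B` is `b_0 ⊗ ⋯ ⊗ b_{r-1}`.
The operator `e_i` acts on the factor with the smallest index `s` such that `ε_i^s = ε_i`, and `f_i`
on the factor with the largest index `t` such that `φ_i^t = φ_i`. -/
def tensorPower (C : GLCrystalData k B) (r : ℕ) : GLCrystalData k (Fin r → B) where
  e i b :=
    if h : (Finset.univ.filter fun s => C.tensorEpsAt i b s = C.tensorEps i b).Nonempty then
      let s := Finset.min' _ h
      (C.e i (b s)).map (Function.update b s)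
    else none
  f i b :=
    if h : (Finset.univ.filter fun t => C.tensorPhiAt i b t = C.tensorPhi i b).Nonempty then
      let t := Finset.max' _ h
      (C.f i (b t)).map (Function.update b t)
    else none
  eps i b := C.tensorEps i b
  phi i b := C.tensorPhi i b
  wt b := ∑ j, C.wt (b j)

/-- Transport of a crystal along a bijection of the underlying sets. -/
def transport {A : Type} (C : GLCrystalData k B) (g : A ≃ B) : GLCrystalData k A where
  e i a := (C.e i (g a)).map g.symm
  f i a := (C.f i (g a)).map g.symm
  eps i a := C.eps i (g a)
  phi i a := C.phi i (g a)
  wt a := C.wt (g a)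

/-- `b` and `b'` lie in the same connected component of the crystal graph restricted to the
arrows with labels in `J`. -/
def SameComponent (C : GLCrystalData k B) (J : Set (Fin (k - 1))) : B → B → Prop :=
  Relation.EqvGen fun b b' => ∃ i ∈ J, C.f i b = some b'

/-- The defining property of the Schützenberger involution of the restriction of `C` to a set `J`
of simple roots with diagram automorphism `θ` and longest Weyl group element `w`: it maps every
connected component of the restricted crystal to itself, exchanges the raising and the lowering
operators through `θ`, and acts on weights by `w`. -/
structure IsSchutzenberger (C : GLCrystalData k B) (J : Set (Fin (k - 1)))
    (θ : Fin (k - 1) → Fin (k - 1)) (w : Fin k → Fin k) (ξ : B → B) : Prop where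
  component : ∀ b, C.SameComponent J b (ξ b)
  e_comm : ∀ i ∈ J, ∀ b, C.e i (ξ b) = (C.f (θ i) b).map ξ
  f_comm : ∀ i ∈ J, ∀ b, C.f i (ξ b) = (C.e (θ i) b).map ξ
  wt_comm : ∀ b a, C.wt (ξ b) a = C.wt b (w a)

/-- The Schützenberger property for the whole Dynkin diagram of `gl_k`: here `θ` and `w_0` reverse
the order of the simple roots and of the positions. -/
def IsFullSchutzenberger (C : GLCrystalData k B) (ξ : B → B) : Prop :=
  C.IsSchutzenberger Set.univ Fin.rev Fin.rev ξ

/-- The simple roots joining the positions of the interval `[p, q]`. -/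
def intervalRoots (p q : Fin k) : Set (Fin (k - 1)) :=
  {i | p.val ≤ i.val ∧ i.val < q.val}

/-- The diagram automorphism of `intervalRoots p q`, which reverses the order. -/
def intervalTheta (p q : Fin k) (i : Fin (k - 1)) : Fin (k - 1) :=
  if h : p.val ≤ i.val ∧ i.val < q.val then
    ⟨p.val + q.val - 1 - i.val, by have := q.isLt; omega⟩
  else i

/-- The longest Weyl group element for `intervalRoots p q`, which reverses the order of the
positions in `[p, q]` and fixes the others. -/
def intervalRev (p q : Fin k) (a : Fin k) : Fin k :=
  if h : p.val ≤ a.val ∧ a.val ≤ q.val then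
    ⟨p.val + q.val - a.val, by have := q.isLt; omega⟩
  else a

/-- The Schützenberger property for the subdiagram `intervalRoots p q`. -/
def IsIntervalSchutzenberger (C : GLCrystalData k B) (p q : Fin k) (ξ : B → B) : Prop :=
  C.IsSchutzenberger (intervalRoots p q) (intervalTheta p q) (intervalRev p q) ξ

open Classical in
/-- The Schützenberger involution of a `gl_k`-crystal. -/
noncomputable def schutzenberger (C : GLCrystalData k B) : B → B :=
  if h : ∃ ξ, C.IsFullSchutzenberger ξ then h.choose else id

open Classical in
/-- The inner action of the generator `s_{p,q}` of the cactus group `C_k` on a `gl_k`-crystal: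
the Schützenberger involution of its restriction to the subdiagram `intervalRoots p q`. -/
noncomputable def innerCactus (C : GLCrystalData k B) (p q : Fin k) : B → B :=
  if h : ∃ ξ, C.IsIntervalSchutzenberger p q ξ then h.choose else id

/-- The outer action of the generator `s_{p,q}` of the cactus group `C_r` on an `r`-fold tensor
power: `b_0 ⊗ ⋯ ⊗ b_{r-1}` is sent to
`b_0 ⊗ ⋯ ⊗ b_{p-1} ⊗ ξ (ξ b_q ⊗ ξ b_{q-1} ⊗ ⋯ ⊗ ξ b_p) ⊗ b_{q+1} ⊗ ⋯ ⊗ b_{r-1}`. -/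
noncomputable def outerCactus (C : GLCrystalData k B) {r : ℕ} (p q : Fin r)
    (b : Fin r → B) : Fin r → B :=
  let c : Fin (q.val - p.val + 1) → B := fun j =>
    C.schutzenberger (b ⟨q.val - j.val, by have := q.isLt; omega⟩)
  let d : Fin (q.val - p.val + 1) → B :=
    (C.tensorPower (q.val - p.val + 1)).schutzenberger c
  fun s => if h : p.val ≤ s.val ∧ s.val ≤ q.val then d ⟨s.val - p.val, by omega⟩ else b s

end GLCrystalData

/-- The set `Λ^K B_{n,m}` of the `n × m` matrices with entries in `{0,1}` and exactly `K` ones. -/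
def LambdaB (K n m : ℕ) : Set (Matrix (Fin n) (Fin m) Bool) :=
  {M | (Finset.univ.filter fun x : Fin n × Fin m => M x.1 x.2 = true).card = K}

/-- A matrix with rows `r_1, …, r_n` corresponds to `r_1 ⊗ ⋯ ⊗ r_n`. -/
def rowTensor (n m : ℕ) : Matrix (Fin n) (Fin m) Bool ≃ (Fin n → Fin m → Bool) :=
  Matrix.of.symm

/-- A matrix with columns `c_1, …, c_m` corresponds to `c_m ⊗ ⋯ ⊗ c_1`. -/
def colTensor (n m : ℕ) : Matrix (Fin n) (Fin m) Bool ≃ (Fin m → Fin n → Bool) where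
  toFun M j i := M i j.rev
  invFun b := Matrix.of fun i j => b j.rev i
  left_inv M := by ext i j; simp
  right_inv b := by ext j i; simp

/-- The `gl_m`-crystal structure on all `n × m` matrices with entries in `{0,1}`, which is the
disjoint union over `K` of the `gl_m`-crystals `Λ^K B_{n,m}`. -/
def rowCrystal (n m : ℕ) : GLCrystalData m (Matrix (Fin n) (Fin m) Bool) :=
  ((exteriorCrystal m).tensorPower n).transport (rowTensor n m)

/-- The inner action of `s_{p,q} ∈ C_m` on matrices, through their `gl_m`-crystal structure. -/
noncomputable def innerAction (n m : ℕ) (p q : Fin m) :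
    Matrix (Fin n) (Fin m) Bool → Matrix (Fin n) (Fin m) Bool :=
  (rowCrystal n m).innerCactus p q

/-- The outer action of `s_{p,q} ∈ C_m` on matrices, seen as `m`-fold tensor products of elements
of `gl_n`-crystals through their columns. -/
noncomputable def outerAction (n m : ℕ) (p q : Fin m) :
    Matrix (Fin n) (Fin m) Bool → Matrix (Fin n) (Fin m) Bool :=
  fun M => (colTensor n m).symm ((exteriorCrystal n).outerCactus p q (colTensor n m M))

/-! A 0/1 matrix carries two crystal structures, for `gl_m` through its rows and for `gl_n` through
its columns; the quarter turn `rot` exchanges their roles. The proof rests on skew Howe duality: the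
two families of operators commute (`lowering_commute`, `lowers_diamond`), so the operators of one
structure transport along the components of the other.

Raising in both directions ends at a matrix of highest weight for both structures. Such a matrix is
a Young diagram in a corner, hence determined by its row sums, which `gl_m`-operators preserve. It
follows that a `gl_m`-component has a single highest element, and that a `gl_m`-component and a
`gl_n`-component meet in at most one matrix (`RowConn.eq_of_rot`).

Let R be the half turn `rot ∘ rot`. It reverses all arrows of both structures. A doubly highest T is
joined to R T by passing to the `gl_m`-lowest element (a left-right mirror) and then to the
`gl_n`-lowest one (an up-down mirror), so M and R M are always joined by a `gl_m`-path followed by a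
`gl_n`-path (`biConn_rot_rot`). Hence the `gl_m`-component of M and the `gl_n`-component of R M meet
in exactly one matrix, `evac M`. Transport along the `gl_n`-component shows that `evac` is the
`gl_m`-Schützenberger involution.

The same description, read from the other side, says that `evac M` is the `gl_n`-Schützenberger
image of R M (`evac_rot_rot_rot`). On one column the involution is plain reversal, so reversing the
tensor factors and applying ξ to each of them is exactly R, and the remaining outer ξ yields `evac
M`. This is the theorem for the full interval. In general both actions only touch the columns in [p,
q] and agree there by this argument. -/

open Finset

/-! ### Signature rule in terms of lattice walks -/

/-- The `0/1`-matrices as elements of the `gl_m`-crystal of `n`-fold tensor products. -/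
abbrev binCrystal (n m : ℕ) : GLCrystalData m (Fin n → Fin m → Bool) :=
  (exteriorCrystal m).tensorPower n

/-- The entries of a `0/1`-matrix as integers, extended by zero. -/
def entry {n m : ℕ} (M : Fin n → Fin m → Bool) (r c : ℕ) : ℤ :=
  if h : r < n ∧ c < m then (if M ⟨r, h.1⟩ ⟨c, h.2⟩ = true then 1 else 0) else 0

/-- The excess of column `i + 1` over column `i` in the first `t` rows. -/
def rowHeight (x : ℕ → ℕ → ℤ) (i t : ℕ) : ℤ := ∑ s ∈ range t, (x s (i + 1) - x s i)

/-- The excess of row `j` over row `j + 1` in the first `t` columns. -/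
def colHeight (x : ℕ → ℕ → ℤ) (j t : ℕ) : ℤ := ∑ k ∈ range t, (x j k - x (j + 1) k)

/-- `s` is the last point where `g` is maximal. -/
def LastMaxAt (g : ℕ → ℤ) (s : ℕ) : Prop := (∀ u ≤ s, g u ≤ g s) ∧ ∀ u, s < u → g u < g s

/-- `s + 1` is the first point where `g` is maximal. -/
def FirstMaxAfter (g : ℕ → ℤ) (s : ℕ) : Prop :=
  (∀ u ≤ s, g u < g (s + 1)) ∧ ∀ u, s + 1 < u → g u ≤ g (s + 1)

/-- The change of the entries when a one moves from column `i` to column `i + 1` in row `s`. -/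
def rowMove (i s r c : ℕ) : ℤ :=
  if r = s then (if c = i + 1 then 1 else 0) - (if c = i then 1 else 0) else 0

/-- The change of the entries when a one moves from row `j` to row `j + 1` in column `k`. -/
def colMove (j k r c : ℕ) : ℤ :=
  if c = k then (if r = j + 1 then 1 else 0) - (if r = j then 1 else 0) else 0

section entries

variable {n m : ℕ}

lemma entry_of_lt (M : Fin n → Fin m → Bool) {r c : ℕ} (hr : r < n) (hc : c < m) :
    entry M r c = if M ⟨r, hr⟩ ⟨c, hc⟩ = true then 1 else 0 := by
  simp [entry, hr, hc]

lemma entry_val (M : Fin n → Fin m → Bool) (r : Fin n) (c : Fin m) :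
    entry M r c = if M r c = true then 1 else 0 := by
  simp [entry]

lemma entry_lo (M : Fin n → Fin m → Bool) (i : Fin (m - 1)) (s : Fin n) :
    entry M s i = if M s (rootLo i) = true then 1 else 0 :=
  entry_val M s (rootLo i)

lemma entry_hi (M : Fin n → Fin m → Bool) (i : Fin (m - 1)) (s : Fin n) :
    entry M s (i + 1) = if M s (rootHi i) = true then 1 else 0 :=
  entry_val M s (rootHi i)

lemma entry_row_ge (M : Fin n → Fin m → Bool) {r : ℕ} (c : ℕ) (hr : n ≤ r) : entry M r c = 0 := by
  simp [entry, Nat.not_lt.mpr hr]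

lemma entry_col_ge (M : Fin n → Fin m → Bool) (r : ℕ) {c : ℕ} (hc : m ≤ c) : entry M r c = 0 := by
  simp [entry, Nat.not_lt.mpr hc]

lemma entry_eq_zero_or_one (M : Fin n → Fin m → Bool) (r c : ℕ) :
    entry M r c = 0 ∨ entry M r c = 1 := by
  unfold entry; split_ifs <;> simp

lemma entry_injective {M N : Fin n → Fin m → Bool} (h : ∀ r c, entry M r c = entry N r c) :
    M = N := by
  funext r c
  have := h r c
  rw [entry_val, entry_val] at this
  cases h1 : M r c <;> cases h2 : N r c <;> simp_all

lemma rowHeight_zero (x : ℕ → ℕ → ℤ) (i : ℕ) : rowHeight x i 0 = 0 := by simp [rowHeight]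

lemma rowHeight_succ (x : ℕ → ℕ → ℤ) (i t : ℕ) :
    rowHeight x i (t + 1) = rowHeight x i t + (x t (i + 1) - x t i) := by
  rw [rowHeight, sum_range_succ, rowHeight]

lemma colHeight_succ (x : ℕ → ℕ → ℤ) (j t : ℕ) :
    colHeight x j (t + 1) = colHeight x j t + (x j t - x (j + 1) t) := by
  rw [colHeight, sum_range_succ, colHeight]

lemma corootPairing_sum {ι : Type*} {k : ℕ} (i : Fin (k - 1)) (S : Finset ι) (w : ι → Fin k → ℤ) :
    corootPairing i (∑ j ∈ S, w j) = ∑ j ∈ S, corootPairing i (w j) := by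
  simp [corootPairing, Finset.sum_apply]

lemma corootPairing_wt (M : Fin n → Fin m → Bool) (i : Fin (m - 1)) (s : Fin n) :
    corootPairing i ((exteriorCrystal m).wt (M s)) =
      -(entry M s (i.val + 1) - entry M s i.val) := by
  simp [corootPairing, exteriorCrystal, entry_lo, entry_hi]

/-- The pairing with the earlier factors is minus the height at `s`, and `eps` of row `s` is the
positive part of the next step of the walk. -/
lemma tensorEpsAt_eq (M : Fin n → Fin m → Bool) (i : Fin (m - 1)) (s : Fin n) :
    (exteriorCrystal m).tensorEpsAt i M s =
      max (rowHeight (entry M) i s) (rowHeight (entry M) i (s + 1)) := by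
  have hsum : ∑ j ∈ Iio s, corootPairing i ((exteriorCrystal m).wt (M j)) =
      -rowHeight (entry M) i s := by
    simp only [corootPairing_wt, rowHeight, sum_neg_distrib]
    rw [← Nat.Iio_eq_range, ← Fin.map_valEmbedding_Iio, sum_map]
    rfl
  rw [GLCrystalData.tensorEpsAt, corootPairing_sum, hsum, rowHeight_succ]
  simp only [exteriorCrystal, entry_lo, entry_hi]
  cases M s (rootLo i) <;> cases M s (rootHi i) <;> simp <;> omega

/-- Here `phi` is the negative part of the step and the later factors contribute the height at `s +
1` minus the final height. Up to a constant this is the same walk as for `eps`, so both operators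
are governed by the maxima of one function. -/
lemma tensorPhiAt_eq (M : Fin n → Fin m → Bool) (i : Fin (m - 1)) (s : Fin n) :
    (exteriorCrystal m).tensorPhiAt i M s =
      max (rowHeight (entry M) i s) (rowHeight (entry M) i (s + 1)) -
        rowHeight (entry M) i n := by
  have hsum : ∑ j ∈ Ioi s, corootPairing i ((exteriorCrystal m).wt (M j)) =
      rowHeight (entry M) i (s + 1) - rowHeight (entry M) i n := by
    have h3 : ∑ j ∈ Ioi s, corootPairing i ((exteriorCrystal m).wt (M j)) =
        -∑ j ∈ Ico (s.val + 1) n, (entry M j (i.val + 1) - entry M j i.val) := by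
      simp only [corootPairing_wt, sum_neg_distrib]
      have : Ico (s.val + 1) n = (Ioi s).map Fin.valEmbedding := by
        ext a
        rw [Fin.map_valEmbedding_Ioi, mem_Ico, mem_Ioo]; omega
      rw [this, sum_map]
      rfl
    rw [h3, sum_Ico_eq_sub _ (by omega : s.val + 1 ≤ n)]
    simp only [rowHeight]; ring
  rw [GLCrystalData.tensorPhiAt, corootPairing_sum, hsum, rowHeight_succ]
  simp only [exteriorCrystal, entry_lo, entry_hi]
  cases M s (rootLo i) <;> cases M s (rootHi i) <;> simp <;> omega

lemma rowHeight_of_ge (M : Fin n → Fin m → Bool) (i : ℕ) {t : ℕ} (ht : n ≤ t) :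
    rowHeight (entry M) i t = rowHeight (entry M) i n := by
  induction t, ht using Nat.le_induction with
  | base => rfl
  | succ t ht ih => rw [rowHeight_succ, ih, entry_row_ge M _ ht, entry_row_ge M _ ht]; simp

lemma rowHeight_le_tensorEps (M : Fin n → Fin m → Bool) (i : Fin (m - 1)) (t : ℕ) :
    rowHeight (entry M) i t ≤ (exteriorCrystal m).tensorEps i M := by
  unfold GLCrystalData.tensorEps
  rw [le_fold_max]
  rcases Nat.eq_zero_or_pos t with rfl | h0
  · left; rw [rowHeight_zero]
  rcases Nat.eq_zero_or_pos n with rfl | hn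
  · left; rw [rowHeight_of_ge M i (Nat.zero_le t), rowHeight_zero]
  right
  rcases Nat.lt_or_ge t n with h | h
  · exact ⟨⟨t, h⟩, mem_univ _, by rw [tensorEpsAt_eq]; exact le_max_left _ _⟩
  · refine ⟨⟨n - 1, by omega⟩, mem_univ _, ?_⟩
    rw [tensorEpsAt_eq, rowHeight_of_ge M i h]
    simp only [Nat.sub_add_cancel hn]
    exact le_max_right _ _

lemma rowHeight_le_tensorPhi (M : Fin n → Fin m → Bool) (i : Fin (m - 1)) (t : ℕ) :
    rowHeight (entry M) i t - rowHeight (entry M) i n ≤ (exteriorCrystal m).tensorPhi i M := by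
  unfold GLCrystalData.tensorPhi
  rw [le_fold_max]
  rcases Nat.lt_or_ge t n with h | h
  · right
    refine ⟨⟨t, h⟩, mem_univ _, ?_⟩
    rw [tensorPhiAt_eq]
    exact sub_le_sub_right (le_max_left _ _) _
  · left; rw [rowHeight_of_ge M i h, sub_self]

lemma entry_update_swap (M : Fin n → Fin m → Bool) (i : Fin (m - 1)) (s : Fin n) (r c : ℕ) :
    entry (Function.update M s (M s ∘ Equiv.swap (rootLo i) (rootHi i))) r c =
      entry M r c + (entry M s i - entry M s (i + 1)) * rowMove i s r c := by
  rw [entry_lo, entry_hi]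
  by_cases hr : r = s
  · subst hr
    by_cases hc : c < m
    · rw [entry_of_lt _ s.2 hc, entry_of_lt _ s.2 hc]
      simp only [Function.update_self, Function.comp, rowMove, if_true]
      by_cases hlo : c = i
      · subst hlo
        have : Equiv.swap (rootLo i) (rootHi i) ⟨i.val, hc⟩ = rootHi i :=
          Equiv.swap_apply_left _ _
        have h' : (⟨i.val, hc⟩ : Fin m) = rootLo i := rfl
        rw [this, h']
        simp
      · by_cases hhi : c = i + 1
        · subst hhi
          have : Equiv.swap (rootLo i) (rootHi i) ⟨i.val + 1, hc⟩ = rootLo i :=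
            Equiv.swap_apply_right _ _
          have h' : (⟨i.val + 1, hc⟩ : Fin m) = rootHi i := rfl
          rw [this, h']
          simp
        · rw [Equiv.swap_apply_of_ne_of_ne]
          · simp [hlo, hhi]
          · intro h; exact hlo (congrArg Fin.val h)
          · intro h; exact hhi (congrArg Fin.val h)
    · rw [entry_col_ge _ _ (Nat.not_lt.mp hc), entry_col_ge _ _ (Nat.not_lt.mp hc)]
      have := i.2
      have h3 : c ≠ i := by omega
      have h4 : c ≠ i + 1 := by omega
      simp [rowMove, h3, h4]
  · simp only [rowMove, if_neg hr, mul_zero, add_zero]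
    unfold entry
    by_cases h : r < n ∧ c < m
    · rw [dif_pos h, dif_pos h, Function.update_of_ne]
      intro h'; exact hr (congrArg Fin.val h')
    · rw [dif_neg h, dif_neg h]

end entries

/-! ### Crystal operators located by the maxima of the walk -/

section operators

variable {n m : ℕ}

/-- The least factor attaining `tensorEps` is the step by which the walk first reaches its maximum.
If the maximum is the starting value 0, the chosen factor, if any, has no up-step and the operator
vanishes. -/
lemma binCrystal_e_eq_some (M M' : Fin n → Fin m → Bool) (i : Fin (m - 1)) :
    (binCrystal n m).e i M = some M' ↔ ∃ s : ℕ, FirstMaxAfter (rowHeight (entry M) i) s ∧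
      ∀ r c, entry M' r c = entry M r c - rowMove i s r c := by
  constructor
  · intro h
    simp only [binCrystal, GLCrystalData.tensorPower] at h
    split_ifs at h with hne
    generalize hs : Finset.min' _ hne = s at h
    have hmem : (exteriorCrystal m).tensorEpsAt i M s = (exteriorCrystal m).tensorEps i M := by
      have := Finset.min'_mem _ hne
      rw [hs] at this
      simpa using this
    have hmin : ∀ u < s, (exteriorCrystal m).tensorEpsAt i M u <
        (exteriorCrystal m).tensorEps i M := by
      intro u hu
      refine lt_of_le_of_ne ?_ fun hu' => ?_
      · rw [tensorEpsAt_eq]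
        exact max_le (rowHeight_le_tensorEps _ _ _) (rowHeight_le_tensorEps _ _ _)
      · have := Finset.min'_le (univ.filter fun s => (exteriorCrystal m).tensorEpsAt i M s =
          (exteriorCrystal m).tensorEps i M) u (by simpa using hu')
        rw [hs] at this
        exact absurd hu (not_lt.2 this)
    simp only [Option.map_eq_some_iff] at h
    obtain ⟨c, hc, rfl⟩ := h
    have h1 := entry_lo M i s
    have h2 := entry_hi M i s
    simp only [exteriorCrystal] at hc
    split_ifs at hc with hb
    rw [hb.1] at h1
    rw [hb.2] at h2
    simp only [Bool.false_eq_true, if_false, if_true] at h1 h2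
    have hsucc := rowHeight_succ (entry M) i s
    rw [h1, h2] at hsucc
    rw [tensorEpsAt_eq] at hmem
    have hmax : rowHeight (entry M) i (s + 1) = (exteriorCrystal m).tensorEps i M := by
      rw [← hmem, max_eq_right]; omega
    refine ⟨s, ⟨fun u hu => ?_, fun u _ => ?_⟩, fun r c' => ?_⟩
    · rcases hu.lt_or_eq with hu | rfl
      · have := hmin ⟨u, by omega⟩ hu
        rw [tensorEpsAt_eq, ← hmax] at this
        exact lt_of_le_of_lt (le_max_left _ _) this
      · omega
    · rw [hmax]; exact rowHeight_le_tensorEps _ _ _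
    · cases hc
      rw [entry_update_swap, h1, h2]; ring
  · rintro ⟨s, ⟨hs1, hs2⟩, hM'⟩
    have hsucc := rowHeight_succ (entry M) i s
    have hlt := hs1 s le_rfl
    have hsn : s < n := by
      by_contra hsn
      rw [entry_row_ge M _ (not_lt.1 hsn), entry_row_ge M _ (not_lt.1 hsn)] at hsucc
      omega
    have hle : ∀ u, rowHeight (entry M) i u ≤ rowHeight (entry M) i (s + 1) := by
      intro u
      rcases lt_trichotomy u (s + 1) with h | h | h
      · exact (hs1 u (by omega)).le
      · rw [h]
      · exact hs2 u h
    have heps : (exteriorCrystal m).tensorEps i M = rowHeight (entry M) i (s + 1) := by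
      refine le_antisymm ?_ (rowHeight_le_tensorEps _ _ _)
      unfold GLCrystalData.tensorEps
      rw [fold_max_le]
      refine ⟨by have := hle 0; rwa [rowHeight_zero] at this, fun u _ => ?_⟩
      rw [tensorEpsAt_eq]
      exact max_le (hle _) (hle _)
    have hmem : (⟨s, hsn⟩ : Fin n) ∈ univ.filter fun s =>
        (exteriorCrystal m).tensorEpsAt i M s = (exteriorCrystal m).tensorEps i M := by
      rw [mem_filter, tensorEpsAt_eq, heps]
      exact ⟨mem_univ _, max_eq_right hlt.le⟩
    have hmin : Finset.min' _ ⟨_, hmem⟩ = (⟨s, hsn⟩ : Fin n) := by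
      refine le_antisymm (Finset.min'_le _ _ hmem) (Finset.le_min' _ _ _ fun u hu => ?_)
      by_contra hlt'
      rw [not_le] at hlt'
      rw [mem_filter, tensorEpsAt_eq, heps] at hu
      have h1 := hs1 u (le_of_lt hlt')
      have h2 := hs1 (u + 1) hlt'
      exact absurd hu.2 (max_lt h1 h2).ne
    have h1 : entry M s i = _ := entry_lo M i ⟨s, hsn⟩
    have h2 : entry M s (i + 1) = _ := entry_hi M i ⟨s, hsn⟩
    rw [h1, h2] at hsucc
    have hb : M ⟨s, hsn⟩ (rootLo i) = false ∧ M ⟨s, hsn⟩ (rootHi i) = true := by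
      clear h1 h2
      revert hsucc
      cases M ⟨s, hsn⟩ (rootLo i) <;> cases M ⟨s, hsn⟩ (rootHi i) <;> simp <;> omega
    simp only [binCrystal, GLCrystalData.tensorPower]
    rw [dif_pos ⟨_, hmem⟩, hmin]
    simp only [exteriorCrystal]
    rw [if_pos hb]
    simp only [Option.map_some, Option.some.injEq]
    refine entry_injective fun r c => ?_
    rw [entry_update_swap, hM']
    simp only [h1, h2, hb.1, hb.2]
    simp [sub_eq_add_neg]

lemma binCrystal_f_eq_some (M M' : Fin n → Fin m → Bool) (i : Fin (m - 1)) :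
    (binCrystal n m).f i M = some M' ↔ ∃ s : ℕ, LastMaxAt (rowHeight (entry M) i) s ∧
      ∀ r c, entry M' r c = entry M r c + rowMove i s r c := by
  constructor
  · intro h
    simp only [binCrystal, GLCrystalData.tensorPower] at h
    split_ifs at h with hne
    generalize hs : Finset.max' _ hne = s at h
    have hmem : (exteriorCrystal m).tensorPhiAt i M s = (exteriorCrystal m).tensorPhi i M := by
      have := Finset.max'_mem _ hne
      rw [hs] at this
      simpa using this
    have hmin : ∀ u, s < u → (exteriorCrystal m).tensorPhiAt i M u <
        (exteriorCrystal m).tensorPhi i M := by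
      intro u hu
      refine lt_of_le_of_ne ?_ fun hu' => ?_
      · rw [tensorPhiAt_eq, sub_le_iff_le_add]
        exact max_le (sub_le_iff_le_add.1 (rowHeight_le_tensorPhi _ _ _))
          (sub_le_iff_le_add.1 (rowHeight_le_tensorPhi _ _ _))
      · have := Finset.le_max' (univ.filter fun s => (exteriorCrystal m).tensorPhiAt i M s =
          (exteriorCrystal m).tensorPhi i M) u (by simpa using hu')
        rw [hs] at this
        exact absurd hu (not_lt.2 this)
    simp only [Option.map_eq_some_iff] at h
    obtain ⟨c, hc, rfl⟩ := h
    have h1 := entry_lo M i s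
    have h2 := entry_hi M i s
    simp only [exteriorCrystal] at hc
    split_ifs at hc with hb
    rw [hb.1] at h1
    rw [hb.2] at h2
    simp only [Bool.false_eq_true, if_false, if_true] at h1 h2
    have hsucc := rowHeight_succ (entry M) i s
    rw [h1, h2] at hsucc
    rw [tensorPhiAt_eq, max_eq_left (by omega)] at hmem
    refine ⟨s, ⟨fun u _ => ?_, fun u hu => ?_⟩, fun r c' => ?_⟩
    · have := rowHeight_le_tensorPhi M i u
      omega
    · rcases Nat.lt_or_ge u n with hun | hun
      · have := hmin ⟨u, hun⟩ hu
        rw [tensorPhiAt_eq] at this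
        have h3 := le_max_left (rowHeight (entry M) i u) (rowHeight (entry M) i (u + 1))
        simp only at this
        omega
      · rw [rowHeight_of_ge M i hun]
        rcases Nat.lt_or_ge (s + 1) n with hsn | hsn
        · have := hmin ⟨n - 1, by omega⟩ (by rw [Fin.lt_def]; simp only; omega)
          rw [tensorPhiAt_eq] at this
          simp only [Nat.sub_add_cancel (by omega : 1 ≤ n)] at this
          have h3 := le_max_right (rowHeight (entry M) i (n - 1)) (rowHeight (entry M) i n)
          omega
        · have := rowHeight_of_ge M i hsn
          omega
    · cases hc
      rw [entry_update_swap, h1, h2]; ring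
  · rintro ⟨s, ⟨hs1, hs2⟩, hM'⟩
    have hsucc := rowHeight_succ (entry M) i s
    have hlt := hs2 (s + 1) (by omega)
    have hsn : s < n := by
      by_contra hsn
      rw [entry_row_ge M _ (not_lt.1 hsn), entry_row_ge M _ (not_lt.1 hsn)] at hsucc
      omega
    have hle : ∀ u, rowHeight (entry M) i u ≤ rowHeight (entry M) i s := by
      intro u
      rcases Nat.lt_or_ge s u with h | h
      · exact (hs2 u h).le
      · exact hs1 u h
    have hphi : (exteriorCrystal m).tensorPhi i M =
        rowHeight (entry M) i s - rowHeight (entry M) i n := by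
      refine le_antisymm ?_ (rowHeight_le_tensorPhi _ _ _)
      unfold GLCrystalData.tensorPhi
      rw [fold_max_le]
      refine ⟨sub_nonneg.2 (hle n), fun u _ => ?_⟩
      rw [tensorPhiAt_eq]
      exact sub_le_sub_right (max_le (hle _) (hle _)) _
    have hmem : (⟨s, hsn⟩ : Fin n) ∈ univ.filter fun s =>
        (exteriorCrystal m).tensorPhiAt i M s = (exteriorCrystal m).tensorPhi i M := by
      rw [mem_filter, tensorPhiAt_eq, hphi]
      exact ⟨mem_univ _, by rw [max_eq_left hlt.le]⟩
    have hmax : Finset.max' _ ⟨_, hmem⟩ = (⟨s, hsn⟩ : Fin n) := by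
      refine le_antisymm (Finset.max'_le _ _ _ fun u hu => ?_) (Finset.le_max' _ _ hmem)
      by_contra hlt'
      rw [not_le] at hlt'
      rw [mem_filter, tensorPhiAt_eq, hphi] at hu
      have h1 := hs2 u hlt'
      have h2 := hs2 (u + 1) (Nat.lt_succ_of_lt hlt')
      have h3 := max_lt h1 h2
      have h4 := hu.2
      omega
    have h1 : entry M s i = _ := entry_lo M i ⟨s, hsn⟩
    have h2 : entry M s (i + 1) = _ := entry_hi M i ⟨s, hsn⟩
    rw [h1, h2] at hsucc
    have hb : M ⟨s, hsn⟩ (rootLo i) = true ∧ M ⟨s, hsn⟩ (rootHi i) = false := by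
      clear h1 h2
      revert hsucc
      cases M ⟨s, hsn⟩ (rootLo i) <;> cases M ⟨s, hsn⟩ (rootHi i) <;> simp <;> omega
    simp only [binCrystal, GLCrystalData.tensorPower]
    rw [dif_pos ⟨_, hmem⟩, hmax]
    simp only [exteriorCrystal]
    rw [if_pos hb]
    simp only [Option.map_some, Option.some.injEq]
    refine entry_injective fun r c => ?_
    rw [entry_update_swap, hM']
    simp only [h1, h2, hb.1, hb.2]
    simp

end operators

/-! ### Commutation of row and column operators -/

lemma sum_range_eq_of_adjacent {g g' : ℕ → ℤ} {j : ℕ} (h : ∀ s, s ≠ j → s ≠ j + 1 → g' s = g s)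
    (hj : g' j + g' (j + 1) = g j + g (j + 1)) {t : ℕ} (ht : t ≠ j + 1) :
    ∑ s ∈ range t, g' s = ∑ s ∈ range t, g s := by
  rcases Nat.lt_or_ge t (j + 1) with hlt | hge
  · refine sum_congr rfl fun s hs => ?_
    rw [mem_range] at hs
    exact h s (by omega) (by omega)
  · have hge : j + 2 ≤ t := by omega
    clear ht
    induction t, hge using Nat.le_induction with
    | base =>
      rw [sum_range_succ, sum_range_succ, sum_range_succ (n := j + 1), sum_range_succ (n := j),
        add_assoc, add_assoc, hj]
      congr 1
      refine sum_congr rfl fun s hs => ?_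
      rw [mem_range] at hs
      exact h s (by omega) (by omega)
    | succ t ht ih =>
      rw [sum_range_succ, sum_range_succ, ih (by omega), h t (by omega) (by omega)]

/-- A one passing from row `j` to row `j + 1` is seen by the partial sums over rows only at the cut
between these two rows. So a move of one kind perturbs a walk of the other kind at a single point,
by at most one. -/
lemma rowHeight_add_colMove_of_ne (x : ℕ → ℕ → ℤ) (i j k : ℕ) {t : ℕ} (ht : t ≠ j + 1) :
    rowHeight (fun r c => x r c + colMove j k r c) i t = rowHeight x i t := by
  refine sum_range_eq_of_adjacent (j := j) (fun s h1 h2 => ?_) ?_ ht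
  · simp [colMove, h1, h2]
  · simp only [colMove]
    split_ifs <;> omega

lemma rowHeight_add_colMove (x : ℕ → ℕ → ℤ) (i j k : ℕ) :
    rowHeight (fun r c => x r c + colMove j k r c) i (j + 1) = rowHeight x i (j + 1) +
      (if k = i then 1 else 0) - (if k = i + 1 then 1 else 0) := by
  rw [rowHeight_succ, rowHeight_succ, rowHeight_add_colMove_of_ne _ _ _ _ (by omega)]
  simp only [colMove]
  split_ifs <;> omega

lemma colHeight_add_rowMove_of_ne (x : ℕ → ℕ → ℤ) (i j s : ℕ) {t : ℕ} (ht : t ≠ i + 1) :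
    colHeight (fun r c => x r c + rowMove i s r c) j t = colHeight x j t := by
  refine sum_range_eq_of_adjacent (j := i) (fun c h1 h2 => ?_) ?_ ht
  · simp [rowMove, h1, h2]
  · simp only [rowMove]
    split_ifs <;> omega

lemma colHeight_add_rowMove (x : ℕ → ℕ → ℤ) (i j s : ℕ) :
    colHeight (fun r c => x r c + rowMove i s r c) j (i + 1) = colHeight x j (i + 1) -
      (if s = j then 1 else 0) + (if s = j + 1 then 1 else 0) := by
  rw [colHeight_succ, colHeight_succ, colHeight_add_rowMove_of_ne _ _ _ _ (by omega)]
  simp only [rowMove]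
  split_ifs <;> omega

/-- The lowering operators on rows and on columns commute. -/
lemma lowering_commute {x : ℕ → ℕ → ℤ} (hx : ∀ r c, x r c = 0 ∨ x r c = 1) {i j s k : ℕ}
    (hs : LastMaxAt (rowHeight x i) s) (hk : FirstMaxAfter (colHeight x j) k) :
    ∃ s' k', LastMaxAt (rowHeight (fun r c => x r c + colMove j k r c) i) s' ∧
      FirstMaxAfter (colHeight (fun r c => x r c + rowMove i s r c) j) k' ∧
      ∀ r c, x r c + rowMove i s r c + colMove j k' r c =
        x r c + colMove j k r c + rowMove i s' r c := by
  have hne1 := fun t (ht : t ≠ j + 1) => rowHeight_add_colMove_of_ne x i j k ht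
  have he1 := rowHeight_add_colMove x i j k
  have hne2 := fun t (ht : t ≠ i + 1) => colHeight_add_rowMove_of_ne x i j s ht
  have he2 := colHeight_add_rowMove x i j s
  have r1 := rowHeight_succ x i j
  have r2 := rowHeight_succ x i (j + 1)
  have c1 := colHeight_succ x j i
  have c2 := colHeight_succ x j (i + 1)
  have xa := hx j i
  have xb := hx j (i + 1)
  have xc := hx (j + 1) i
  have xd := hx (j + 1) (i + 1)
  obtain ⟨hs1, hs2⟩ := hs
  obtain ⟨hk1, hk2⟩ := hk
  generalize rowHeight (fun r c => x r c + colMove j k r c) i = D' at *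
  generalize colHeight (fun r c => x r c + rowMove i s r c) j = E' at *
  generalize rowHeight x i = D at *
  generalize colHeight x j = E at *
  have hs1j := hs1 j
  have hs1j' := hs1 (j + 1)
  have hs1j2 := hs1 (j + 2)
  have hs2j := hs2 j
  have hs2j' := hs2 (j + 1)
  have hs2j2 := hs2 (j + 2)
  have hk1i := hk1 i
  have hk1i' := hk1 (i + 1)
  have hk1i2 := hk1 (i + 2)
  have hk2i := hk2 i
  have hk2i' := hk2 (i + 1)
  have hk2i2 := hk2 (i + 2)
  have hs2s := hs2 (s + 1) (by omega)
  have hk1k := hk1 k le_rfl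
  -- The moves interact only if `s` is `j` or `j + 1` and `k` is `i` or `i + 1`, that is, inside one
  -- 2 × 2 block of entries.
  by_cases hsj : s = j
  · subst hsj
    by_cases hki : k = i
    · subst hki
      -- Both operators move the one at `(j, i)`, the only one in the block. Each perturbation
      -- shifts the relevant maximum by one place, and along either path this one ends at `(j + 1, i
      -- + 1)`.
      refine ⟨s + 1, k + 1, ⟨?_, ?_⟩, ⟨?_, ?_⟩, ?_⟩
      · grind
      · grind
      · grind
      · grind
      · intro r c
        simp only [rowMove, colMove]
        grind
    by_cases hki' : k = i + 1
    -- Impossible: the row move needs a zero at `(j, i + 1)`, the column move a one.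
    · grind
    refine ⟨s, k, ⟨?_, ?_⟩, ⟨?_, ?_⟩, fun r c => by ring⟩
    · grind
    · grind
    · grind
    · grind
  by_cases hsj' : s = j + 1
  · subst hsj'
    by_cases hki : k = i
    -- Impossible: the row move needs a one at `(j + 1, i)`, the column move a zero.
    · grind
    by_cases hki' : k = i + 1
    · subst hki'
      -- Maximality forces a one at `(j, i)`, so the block has its only zero at `(j + 1, i + 1)`.
      -- Whichever move fills it first, the other then starts from `(j, i)`, where the final zero
      -- appears.
      refine ⟨j, i, ⟨?_, ?_⟩, ⟨?_, ?_⟩, ?_⟩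
      · grind
      · grind
      · grind
      · grind
      · intro r c
        simp only [rowMove, colMove]
        grind
    refine ⟨j + 1, k, ⟨?_, ?_⟩, ⟨?_, ?_⟩, fun r c => by ring⟩
    · grind
    · grind
    · grind
    · grind
  · refine ⟨s, k, ⟨?_, ?_⟩, ⟨?_, ?_⟩, fun r c => by ring⟩
    · grind
    · grind
    · grind
    · grind

/-! ### The quarter turn exchanging rows and columns -/

section rotation

variable {n m : ℕ}

/-- The rotation of a matrix that turns `r_1 ⊗ ⋯ ⊗ r_n` into `c_m ⊗ ⋯ ⊗ c_1`. -/
def rot (M : Fin n → Fin m → Bool) : Fin m → Fin n → Bool := fun a b => M b a.rev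

/-- The inverse of `rot`. -/
def rotInv (N : Fin m → Fin n → Bool) : Fin n → Fin m → Bool := fun r c => N c.rev r

@[simp] lemma rot_rotInv (N : Fin m → Fin n → Bool) : rot (rotInv N) = N := by
  funext a b; simp [rot, rotInv]

@[simp] lemma rotInv_rot (M : Fin n → Fin m → Bool) : rotInv (rot M) = M := by
  funext a b; simp [rot, rotInv]

lemma rot_injective : Function.Injective (rot : (Fin n → Fin m → Bool) → _) :=
  Function.LeftInverse.injective rotInv_rot

lemma rot_four (M : Fin n → Fin m → Bool) : rot (rot (rot (rot M))) = M := by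
  funext a b; simp [rot]

lemma entry_rot (M : Fin n → Fin m → Bool) {a : ℕ} (b : ℕ) (ha : a < m) :
    entry (rot M) a b = entry M b (m - 1 - a) := by
  have h : m - 1 - a < m := by omega
  have hrev : (⟨a, ha⟩ : Fin m).rev = ⟨m - 1 - a, h⟩ := by
    ext; simp only [Fin.val_rev]; omega
  by_cases hb : b < n
  · rw [entry_of_lt _ ha hb, entry_of_lt _ hb h]
    simp only [rot, hrev]
  · rw [entry_col_ge _ _ (not_lt.1 hb), entry_row_ge _ _ (not_lt.1 hb)]

lemma colHeight_of_ge (M : Fin n → Fin m → Bool) (j : ℕ) {t : ℕ} (ht : m ≤ t) :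
    colHeight (entry M) j t = colHeight (entry M) j m := by
  induction t, ht using Nat.le_induction with
  | base => rfl
  | succ t ht ih => rw [colHeight_succ, ih, entry_col_ge M _ ht, entry_col_ge M _ ht]; simp

/-- The tensor product `c_m ⊗ ⋯ ⊗ c_1` reads the columns backwards, so the row walk of `rot M` is
the column walk of `M` run from its end. This is why last maxima turn into first ones. -/
lemma rowHeight_rot (M : Fin n → Fin m → Bool) (j t : ℕ) :
    rowHeight (entry (rot M)) j t =
      colHeight (entry M) j (m - t) - colHeight (entry M) j m := by
  induction t with
  | zero => simp [rowHeight]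
  | succ t ih =>
    rw [rowHeight_succ, ih]
    by_cases ht : t < m
    · have h1 : m - t = m - (t + 1) + 1 := by omega
      have h2 : m - (t + 1) = m - 1 - t := by omega
      rw [h1, colHeight_succ, entry_rot _ _ ht, entry_rot _ _ ht, h2]
      ring
    · rw [entry_row_ge _ _ (not_lt.1 ht), entry_row_ge _ _ (not_lt.1 ht)]
      have h1 : m - t = m - (t + 1) := by omega
      rw [h1]; ring

lemma colHeight_rot (M : Fin n → Fin m → Bool) (i : Fin (m - 1)) (t : ℕ) :
    colHeight (entry (rot M)) i t = rowHeight (entry M) i.rev t := by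
  have hi := i.2
  refine sum_congr rfl fun k _ => ?_
  rw [entry_rot _ _ (by omega), entry_rot _ _ (by omega), Fin.val_rev]
  congr 2 <;> omega

lemma lastMaxAt_rot_iff (M : Fin n → Fin m → Bool) (j : ℕ) {s : ℕ} (hs : s < m) :
    LastMaxAt (rowHeight (entry (rot M)) j) s ↔
      FirstMaxAfter (colHeight (entry M) j) (m - 1 - s) := by
  have hms : m - 1 - s + 1 = m - s := by omega
  unfold LastMaxAt FirstMaxAfter
  simp only [rowHeight_rot, hms]
  constructor
  · rintro ⟨h1, h2⟩
    refine ⟨fun u hu => ?_, fun u hu => ?_⟩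
    · have := h2 (m - u) (by omega)
      rw [Nat.sub_sub_self (by omega)] at this
      omega
    · rcases Nat.lt_or_ge u m with hum | hum
      · have := h1 (m - u) (by omega)
        rw [Nat.sub_sub_self (by omega)] at this
        omega
      · have := h1 0 (by omega)
        rw [colHeight_of_ge M j hum]
        rw [Nat.sub_zero] at this
        omega
  · rintro ⟨h1, h2⟩
    refine ⟨fun u hu => ?_, fun u hu => ?_⟩
    · rcases hu.lt_or_eq with hu | rfl
      · have := h2 (m - u) (by omega)
        omega
      · exact le_rfl
    · have := h1 (m - u) (by omega)
      omega

lemma entry_rot_add_iff (M M' : Fin n → Fin m → Bool) (j : ℕ) {s : ℕ} (hs : s < m) :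
    (∀ a b, entry (rot M') a b = entry (rot M) a b + rowMove j s a b) ↔
      ∀ r c, entry M' r c = entry M r c + colMove j (m - 1 - s) r c := by
  constructor
  · intro h r c
    by_cases hc : c < m
    · have := h (m - 1 - c) r
      rw [entry_rot _ _ (by omega), entry_rot _ _ (by omega)] at this
      have hcc : m - 1 - (m - 1 - c) = c := by omega
      rw [hcc] at this
      rw [this]
      simp only [rowMove, colMove]
      have : m - 1 - c = s ↔ c = m - 1 - s := by omega
      simp only [this]
    · rw [entry_col_ge _ _ (not_lt.1 hc), entry_col_ge _ _ (not_lt.1 hc)]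
      simp only [colMove]
      rw [if_neg (by omega)]; simp
  · intro h a b
    by_cases ha : a < m
    · rw [entry_rot _ _ ha, entry_rot _ _ ha, h]
      simp only [rowMove, colMove]
      have : m - 1 - a = m - 1 - s ↔ a = s := by omega
      simp only [this]
    · rw [entry_row_ge _ _ (not_lt.1 ha), entry_row_ge _ _ (not_lt.1 ha)]
      simp only [rowMove]
      rw [if_neg (by omega)]; simp

end rotation

/-! ### Two commuting crystal structures and their components -/

section lowering

variable {n m : ℕ}

/-- The arrows of the `gl_m`-crystal graph. -/
def Lowers (i : Fin (m - 1)) (M M' : Fin n → Fin m → Bool) : Prop :=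
  (binCrystal n m).f i M = some M'

lemma lowers_iff {i : Fin (m - 1)} {M M' : Fin n → Fin m → Bool} :
    Lowers i M M' ↔ ∃ s, LastMaxAt (rowHeight (entry M) i) s ∧
      ∀ r c, entry M' r c = entry M r c + rowMove i s r c :=
  binCrystal_f_eq_some M M' i

lemma LastMaxAt.row_lt {M : Fin n → Fin m → Bool} {i s : ℕ}
    (hs : LastMaxAt (rowHeight (entry M) i) s) : s < n := by
  by_contra hsn
  have := hs.2 (s + 1) (by omega)
  rw [rowHeight_of_ge M i (by omega), rowHeight_of_ge M i (not_lt.1 hsn)] at this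
  omega

lemma FirstMaxAfter.col_lt {M : Fin n → Fin m → Bool} {j k : ℕ}
    (hk : FirstMaxAfter (colHeight (entry M) j) k) : k < m := by
  by_contra hkm
  have := hk.1 k le_rfl
  rw [colHeight_of_ge M j (by omega : m ≤ k + 1), colHeight_of_ge M j (not_lt.1 hkm)] at this
  omega

lemma LastMaxAt.exists_lowers {M : Fin n → Fin m → Bool} {i : Fin (m - 1)} {s : ℕ}
    (hs : LastMaxAt (rowHeight (entry M) i) s) :
    ∃ M', Lowers i M M' ∧ ∀ r c, entry M' r c = entry M r c + rowMove i s r c := by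
  have hsn := hs.row_lt
  have h1 := hs.2 (s + 1) (by omega)
  rw [rowHeight_succ] at h1
  have h2 := entry_eq_zero_or_one M s i
  have h3 := entry_eq_zero_or_one M s (i + 1)
  have h4 := entry_update_swap M i ⟨s, hsn⟩
  have h5 : entry M s i - entry M s (i + 1) = 1 := by omega
  simp only [h5, one_mul] at h4
  exact ⟨_, lowers_iff.2 ⟨s, hs, h4⟩, h4⟩

lemma lowers_rot_iff {j : Fin (n - 1)} {M M' : Fin n → Fin m → Bool} :
    Lowers j (rot M) (rot M') ↔ ∃ k, FirstMaxAfter (colHeight (entry M) j) k ∧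
      ∀ r c, entry M' r c = entry M r c + colMove j k r c := by
  rw [lowers_iff]
  constructor
  · rintro ⟨s, hs, h⟩
    have hsm := hs.row_lt
    exact ⟨m - 1 - s, (lastMaxAt_rot_iff M j hsm).1 hs, (entry_rot_add_iff M M' j hsm).1 h⟩
  · rintro ⟨k, hk, h⟩
    have hkm := hk.col_lt
    have hkk : m - 1 - (m - 1 - k) = k := by omega
    have hlt : m - 1 - k < m := by omega
    exact ⟨m - 1 - k, (lastMaxAt_rot_iff M j hlt).2 (by rwa [hkk]),
      (entry_rot_add_iff M M' j hlt).2 (by rwa [hkk])⟩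

lemma rowHeight_add_rowMove (x : ℕ → ℕ → ℤ) (i s t : ℕ) :
    rowHeight (fun r c => x r c + rowMove i s r c) i t =
      rowHeight x i t + if s < t then 2 else 0 := by
  induction t with
  | zero => simp [rowHeight]
  | succ t ih =>
    rw [rowHeight_succ, rowHeight_succ, ih]
    simp only [rowMove]
    split_ifs <;> omega

/-- Lowering in row `s` adds 2 to the walk after `s`. If `s` was the last maximum, with value H, the
value at `s + 1` rises from H - 1 to H + 1 and becomes the first maximum; conversely likewise. -/
lemma e_eq_some_iff {i : Fin (m - 1)} {M M' : Fin n → Fin m → Bool} :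
    (binCrystal n m).e i M' = some M ↔ Lowers i M M' := by
  rw [lowers_iff, binCrystal_e_eq_some]
  refine exists_congr fun s => ?_
  have key : (∀ r c, entry M' r c = entry M r c + rowMove i s r c) →
      (FirstMaxAfter (rowHeight (entry M') i) s ↔ LastMaxAt (rowHeight (entry M) i) s) := by
    intro h
    have hfun : entry M' = fun r c => entry M r c + rowMove i s r c := by
      funext r c; exact h r c
    have hstep := rowHeight_succ (entry M) i s
    have hstep' := rowHeight_succ (entry M') i s
    have a1 := entry_eq_zero_or_one M s i
    have a2 := entry_eq_zero_or_one M s (i + 1)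
    have a3 := entry_eq_zero_or_one M' s i
    have a4 := entry_eq_zero_or_one M' s (i + 1)
    have b3 := h s i
    have b4 := h s (i + 1)
    simp only [rowMove, if_true] at b3 b4
    rw [if_neg (by omega)] at b3 b4
    unfold FirstMaxAfter LastMaxAt
    simp only [hfun, rowHeight_add_rowMove]
    constructor
    · rintro ⟨h1, h2⟩
      refine ⟨fun u hu => ?_, fun u hu => ?_⟩
      · have := h1 u hu
        split_ifs at this <;> omega
      · rcases Nat.lt_or_ge (s + 1) u with hu' | hu'
        · have := h2 u hu'
          split_ifs at this <;> omega
        · have : u = s + 1 := by omega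
          subst this; omega
    · rintro ⟨h1, h2⟩
      refine ⟨fun u hu => ?_, fun u hu => ?_⟩
      · have := h1 u hu
        split_ifs <;> omega
      · have := h2 u (by omega)
        split_ifs <;> omega
  constructor
  · rintro ⟨h1, h2⟩
    have h3 : ∀ r c, entry M' r c = entry M r c + rowMove i s r c := fun r c => by
      rw [h2]; ring
    exact ⟨(key h3).1 h1, h3⟩
  · rintro ⟨h1, h2⟩
    exact ⟨(key h2).2 h1, fun r c => by rw [h2]; ring⟩

lemma Lowers.unique_right {i : Fin (m - 1)} {M M₁ M₂ : Fin n → Fin m → Bool}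
    (h₁ : Lowers i M M₁) (h₂ : Lowers i M M₂) : M₁ = M₂ :=
  Option.some_injective _ (h₁.symm.trans h₂)

/-- The half turn reverses the columns, which exchanges raising with lowering and reverses the
labels; reversing the rows as well matches the leftmost and rightmost choices in the tensor rule. -/
lemma lowers_rot_rot_iff {i : Fin (m - 1)} {M M' : Fin n → Fin m → Bool} :
    Lowers i (rot (rot M)) (rot (rot M')) ↔ Lowers i.rev M' M := by
  rw [lowers_rot_iff, ← e_eq_some_iff, binCrystal_e_eq_some]
  refine exists_congr fun k => and_congr ?_ ?_
  · have : colHeight (entry (rot M)) i = rowHeight (entry M) i.rev :=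
      funext fun t => colHeight_rot M i t
    rw [this]
  · have hi := i.2
    constructor
    · intro h r c
      by_cases hc : c < m
      · have := h (m - 1 - c) r
        rw [entry_rot _ _ (by omega), entry_rot _ _ (by omega)] at this
        have hcc : m - 1 - (m - 1 - c) = c := by omega
        rw [hcc] at this
        rw [this]
        simp only [rowMove, colMove, Fin.val_rev]
        split_ifs <;> omega
      · rw [entry_col_ge _ _ (not_lt.1 hc), entry_col_ge _ _ (not_lt.1 hc)]
        simp only [rowMove, Fin.val_rev]
        split_ifs <;> omega
    · intro h a b
      by_cases ha : a < m
      · rw [entry_rot _ _ ha, entry_rot _ _ ha, h]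
        simp only [rowMove, colMove, Fin.val_rev]
        split_ifs <;> omega
      · rw [entry_row_ge _ _ (not_lt.1 ha), entry_row_ge _ _ (not_lt.1 ha)]
        simp only [colMove]
        split_ifs <;> omega

/-- The `gl_m`- and the `gl_n`-operators commute. -/
lemma lowers_diamond {i : Fin (m - 1)} {j : Fin (n - 1)} {M M₁ M₂ : Fin n → Fin m → Bool}
    (h₁ : Lowers i M M₁) (h₂ : Lowers j (rot M) (rot M₂)) :
    ∃ P, Lowers j (rot M₁) (rot P) ∧ Lowers i M₂ P := by
  obtain ⟨s, hs, e₁⟩ := lowers_iff.1 h₁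
  obtain ⟨k, hk, e₂⟩ := lowers_rot_iff.1 h₂
  obtain ⟨s', k', hs', hk', he⟩ := lowering_commute (entry_eq_zero_or_one M) hs hk
  have f₁ : (fun r c => entry M r c + rowMove i s r c) = entry M₁ := by
    funext r c; exact (e₁ r c).symm
  have f₂ : (fun r c => entry M r c + colMove j k r c) = entry M₂ := by
    funext r c; exact (e₂ r c).symm
  rw [f₂] at hs'
  rw [f₁] at hk'
  obtain ⟨P, hP, eP⟩ := hs'.exists_lowers
  refine ⟨P, lowers_rot_iff.2 ⟨k', hk', fun r c => ?_⟩, hP⟩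
  rw [eP, e₁, e₂, he]

/-- The diamond for `rot M`: there the `gl_n`-operators act on rows, and the `gl_m`-operators act
through the half turn of `M`, which reverses their arrows. Further quarter turns give the remaining
two sign combinations. -/
lemma raises_lowers_diamond {i : Fin (m - 1)} {j : Fin (n - 1)} {M M₁ M₂ : Fin n → Fin m → Bool}
    (h₁ : Lowers i M₁ M) (h₂ : Lowers j (rot M) (rot M₂)) :
    ∃ P, Lowers j (rot M₁) (rot P) ∧ Lowers i P M₂ := by
  have h₁' : Lowers i.rev (rot (rot M)) (rot (rot M₁)) := by
    rwa [lowers_rot_rot_iff, Fin.rev_rev]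
  obtain ⟨P, hP₁, hP₂⟩ := lowers_diamond h₂ h₁'
  rw [← rot_rotInv P] at hP₁ hP₂
  rw [lowers_rot_rot_iff, Fin.rev_rev] at hP₁
  exact ⟨_, hP₂, hP₁⟩

lemma raises_diamond {i : Fin (m - 1)} {j : Fin (n - 1)} {M M₁ M₂ : Fin n → Fin m → Bool}
    (h₁ : Lowers i M₁ M) (h₂ : Lowers j (rot M₂) (rot M)) :
    ∃ P, Lowers j (rot P) (rot M₁) ∧ Lowers i P M₂ := by
  have h₁' : Lowers i.rev (rot (rot M)) (rot (rot M₁)) := by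
    rwa [lowers_rot_rot_iff, Fin.rev_rev]
  obtain ⟨P, hP₁, hP₂⟩ := raises_lowers_diamond h₂ h₁'
  rw [← rot_rotInv P] at hP₁ hP₂
  rw [lowers_rot_rot_iff, Fin.rev_rev] at hP₁
  exact ⟨_, hP₂, hP₁⟩

lemma lowers_raises_diamond {i : Fin (m - 1)} {j : Fin (n - 1)} {M M₁ M₂ : Fin n → Fin m → Bool}
    (h₁ : Lowers i M M₁) (h₂ : Lowers j (rot M₂) (rot M)) :
    ∃ P, Lowers j (rot P) (rot M₁) ∧ Lowers i M₂ P := by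
  have h₁' : Lowers i.rev (rot (rot M₁)) (rot (rot M)) := by
    rwa [lowers_rot_rot_iff, Fin.rev_rev]
  obtain ⟨P, hP₁, hP₂⟩ := raises_diamond h₂ h₁'
  rw [← rot_rotInv P] at hP₁ hP₂
  rw [lowers_rot_rot_iff, Fin.rev_rev] at hP₁
  exact ⟨_, hP₂, hP₁⟩

/-- Two matrices are `RowConn`ected if they lie in the same component of the `gl_m`-crystal.
They lie in the same component of the `gl_n`-crystal if their rotations are `RowConn`ected. -/
def RowConn (M M' : Fin n → Fin m → Bool) : Prop :=
  (binCrystal n m).SameComponent Set.univ M M'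

lemma RowConn.refl (M : Fin n → Fin m → Bool) : RowConn M M := Relation.EqvGen.refl M

lemma RowConn.symm {M M' : Fin n → Fin m → Bool} (h : RowConn M M') : RowConn M' M :=
  Relation.EqvGen.symm _ _ h

lemma RowConn.trans {M M' M'' : Fin n → Fin m → Bool} (h : RowConn M M') (h' : RowConn M' M'') :
    RowConn M M'' := Relation.EqvGen.trans _ _ _ h h'

lemma Lowers.rowConn {i : Fin (m - 1)} {M M' : Fin n → Fin m → Bool} (h : Lowers i M M') :
    RowConn M M' := Relation.EqvGen.rel _ _ ⟨i, Set.mem_univ i, h⟩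

lemma RowConn.induction {r : (Fin n → Fin m → Bool) → (Fin n → Fin m → Bool) → Prop}
    (hl : ∀ i M M', Lowers i M M' → r M M') (hr : ∀ M, r M M)
    (hs : ∀ M M', r M M' → r M' M) (ht : ∀ M M' M'', r M M' → r M' M'' → r M M'')
    {M M' : Fin n → Fin m → Bool} (h : RowConn M M') : r M M' := by
  unfold RowConn GLCrystalData.SameComponent at h
  induction h with
  | rel _ _ h => obtain ⟨i, _, h⟩ := h; exact hl i _ _ h
  | refl => exact hr _
  | symm _ _ _ ih => exact hs _ _ ih
  | trans _ _ _ _ _ ih₁ ih₂ => exact ht _ _ _ ih₁ ih₂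

lemma RowConn.rot_rot {M M' : Fin n → Fin m → Bool} (h : RowConn M M') :
    RowConn (rot (rot M)) (rot (rot M')) := by
  refine RowConn.induction (r := fun M M' => RowConn (rot (rot M)) (rot (rot M'))) ?_ ?_ ?_ ?_ h
  · intro i M M' h
    have : Lowers i.rev (rot (rot M')) (rot (rot M)) := by rwa [lowers_rot_rot_iff, Fin.rev_rev]
    exact this.rowConn.symm
  · exact fun M => RowConn.refl _
  · exact fun _ _ h => h.symm
  · exact fun _ _ _ h h' => h.trans h'

/-- The `gl_n`-operators transport along `gl_m`-components. -/
lemma RowConn.transport_rot {M M' : Fin n → Fin m → Bool} (h : RowConn M M') :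
    (∀ j M₁, Lowers j (rot M) (rot M₁) → ∃ M₁', Lowers j (rot M') (rot M₁') ∧ RowConn M₁ M₁') ∧
    (∀ j M₁, Lowers j (rot M₁) (rot M) → ∃ M₁', Lowers j (rot M₁') (rot M') ∧ RowConn M₁ M₁') := by
  let r := fun M M' : Fin n → Fin m → Bool =>
    (∀ j M₁, Lowers j (rot M) (rot M₁) → ∃ M₁', Lowers j (rot M') (rot M₁') ∧ RowConn M₁ M₁') ∧
    (∀ j M₁, Lowers j (rot M₁) (rot M) → ∃ M₁', Lowers j (rot M₁') (rot M') ∧ RowConn M₁ M₁')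
  have : r M M' ∧ r M' M := by
    refine RowConn.induction (r := fun M M' => r M M' ∧ r M' M) ?_ ?_ ?_ ?_ h
    · intro i M M' h
      refine ⟨⟨fun j M₁ h' => ?_, fun j M₁ h' => ?_⟩, ⟨fun j M₁ h' => ?_, fun j M₁ h' => ?_⟩⟩
      · obtain ⟨P, h₁, h₂⟩ := lowers_diamond h h'
        exact ⟨P, h₁, h₂.rowConn⟩
      · obtain ⟨P, h₁, h₂⟩ := lowers_raises_diamond h h'
        exact ⟨P, h₁, h₂.rowConn⟩
      · obtain ⟨P, h₁, h₂⟩ := raises_lowers_diamond h h'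
        exact ⟨P, h₁, h₂.rowConn.symm⟩
      · obtain ⟨P, h₁, h₂⟩ := raises_diamond h h'
        exact ⟨P, h₁, h₂.rowConn.symm⟩
    · exact fun M => ⟨⟨fun j M₁ h => ⟨M₁, h, .refl _⟩, fun j M₁ h => ⟨M₁, h, .refl _⟩⟩,
        ⟨fun j M₁ h => ⟨M₁, h, .refl _⟩, fun j M₁ h => ⟨M₁, h, .refl _⟩⟩⟩
    · exact fun _ _ h => ⟨h.2, h.1⟩
    · have htrans : ∀ M M' M'', r M M' → r M' M'' → r M M'' := by
        intro M M' M'' h h'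
        refine ⟨fun j M₁ hM => ?_, fun j M₁ hM => ?_⟩
        · obtain ⟨M₂, h₂, c₂⟩ := h.1 j M₁ hM
          obtain ⟨M₃, h₃, c₃⟩ := h'.1 j M₂ h₂
          exact ⟨M₃, h₃, c₂.trans c₃⟩
        · obtain ⟨M₂, h₂, c₂⟩ := h.2 j M₁ hM
          obtain ⟨M₃, h₃, c₃⟩ := h'.2 j M₂ h₂
          exact ⟨M₃, h₃, c₂.trans c₃⟩
      exact fun M M' M'' h h' => ⟨htrans _ _ _ h.1 h'.1, htrans _ _ _ h'.2 h.2⟩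
  exact this.1

/-- The lowering `gl_m`-operators transport along `gl_n`-components. -/
lemma RowConn.transport_lowers {M M' M₁ : Fin n → Fin m → Bool} (h : RowConn (rot M) (rot M'))
    {i : Fin (m - 1)} (hM : Lowers i M M₁) :
    ∃ M₁', Lowers i M' M₁' ∧ RowConn (rot M₁) (rot M₁') := by
  obtain ⟨N, hN, hc⟩ := h.transport_rot.2 i.rev (rot M₁) (by rwa [lowers_rot_rot_iff, Fin.rev_rev])
  rw [← rot_rotInv N] at hN hc
  rw [lowers_rot_rot_iff, Fin.rev_rev] at hN
  exact ⟨_, hN, hc⟩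

/-- The raising `gl_m`-operators transport along `gl_n`-components. -/
lemma RowConn.transport_raises {M M' M₁ : Fin n → Fin m → Bool} (h : RowConn (rot M) (rot M'))
    {i : Fin (m - 1)} (hM : Lowers i M₁ M) :
    ∃ M₁', Lowers i M₁' M' ∧ RowConn (rot M₁) (rot M₁') := by
  obtain ⟨N, hN, hc⟩ := h.transport_rot.1 i.rev (rot M₁) (by rwa [lowers_rot_rot_iff, Fin.rev_rev])
  rw [← rot_rotInv N] at hN hc
  rw [lowers_rot_rot_iff, Fin.rev_rev] at hN
  exact ⟨_, hN, hc⟩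

/-- Moves along `gl_m`- and `gl_n`-components can be interchanged. -/
lemma RowConn.exchange {M M₁ M₂ : Fin n → Fin m → Bool} (h₁ : RowConn M M₁)
    (h₂ : RowConn (rot M) (rot M₂)) : ∃ P, RowConn (rot M₁) (rot P) ∧ RowConn M₂ P := by
  -- The induction runs along the `gl_n`-path, with the end of the `gl_m`-path arbitrary since it
  -- changes at every step.
  let r := fun M M₂ : Fin m → Fin n → Bool => ∀ M₁ : Fin n → Fin m → Bool,
    RowConn (rotInv M) M₁ → ∃ P, RowConn (rot M₁) (rot P) ∧ RowConn (rotInv M₂) P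
  have : r (rot M) (rot M₂) ∧ r (rot M₂) (rot M) := by
    refine RowConn.induction (r := fun M M' => r M M' ∧ r M' M) ?_ ?_ ?_ ?_ h₂
    · intro j N N' h
      rw [← rot_rotInv N, ← rot_rotInv N'] at h
      constructor
      · intro M₁ h₁
        obtain ⟨P, hP, hc⟩ := h₁.transport_rot.1 j _ h
        exact ⟨P, hP.rowConn, hc⟩
      · intro M₁ h₁
        obtain ⟨P, hP, hc⟩ := h₁.transport_rot.2 j _ h
        exact ⟨P, hP.rowConn.symm, hc⟩
    · exact fun N => ⟨fun M₁ h₁ => ⟨M₁, .refl _, h₁⟩, fun M₁ h₁ => ⟨M₁, .refl _, h₁⟩⟩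
    · exact fun _ _ h => ⟨h.2, h.1⟩
    · have htrans : ∀ M M' M'', r M M' → r M' M'' → r M M'' := by
        intro M M' M'' h h' M₁ h₁
        obtain ⟨P, hP, hc⟩ := h M₁ h₁
        obtain ⟨Q, hQ, hd⟩ := h' P hc
        exact ⟨Q, hP.trans hQ, hd⟩
      exact fun M M' M'' h h' => ⟨htrans _ _ _ h.1 h'.1, htrans _ _ _ h'.2 h.2⟩
  have := this.1 M₁ (by rwa [rotInv_rot])
  rwa [rotInv_rot] at this

end lowering

/-! ### Matrices extremal for both structures -/

section corners

variable {n m : ℕ}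

/-- No raising `gl_m`-operator applies. -/
def RowHigh (M : Fin n → Fin m → Bool) : Prop := ∀ i M', ¬ Lowers i M' M

/-- No lowering `gl_m`-operator applies. -/
def RowLow (M : Fin n → Fin m → Bool) : Prop := ∀ i M', ¬ Lowers i M M'

/-- The sum of a row. -/
def rowSum (M : Fin n → Fin m → Bool) (r : ℕ) : ℤ := ∑ c ∈ range m, entry M r c

lemma RowLow.rot_rot {M : Fin n → Fin m → Bool} (h : RowLow M) : RowHigh (rot (rot M)) := by
  intro i N hN
  rw [← rot_rotInv N, ← rot_rotInv (rotInv N), lowers_rot_rot_iff] at hN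
  exact h _ _ hN

lemma RowHigh.rot_rot {M : Fin n → Fin m → Bool} (h : RowHigh M) : RowLow (rot (rot M)) := by
  intro i N hN
  rw [← rot_rotInv N, ← rot_rotInv (rotInv N), lowers_rot_rot_iff] at hN
  exact h _ _ hN

/-- An operator applicable to `M'` would transport back along the `gl_n`-component to `M`. -/
lemma RowHigh.of_rowConn_rot {M M' : Fin n → Fin m → Bool} (hM : RowHigh M)
    (h : RowConn (rot M) (rot M')) : RowHigh M' := by
  intro i N hN
  obtain ⟨P, hP, _⟩ := h.symm.transport_raises hN
  exact hM _ _ hP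

lemma RowLow.of_rowConn_rot {M M' : Fin n → Fin m → Bool} (hM : RowLow M)
    (h : RowConn (rot M) (rot M')) : RowLow M' := by
  intro i N hN
  obtain ⟨P, hP, _⟩ := h.symm.transport_lowers hN
  exact hM _ _ hP

lemma RowHigh.rot_of_rowConn {M M' : Fin n → Fin m → Bool} (hM : RowHigh (rot M))
    (h : RowConn M M') : RowHigh (rot M') :=
  hM.of_rowConn_rot h.rot_rot

lemma RowConn.rowSum_eq {M M' : Fin n → Fin m → Bool} (h : RowConn M M') (r : ℕ) :
    rowSum M r = rowSum M' r := by
  refine RowConn.induction (r := fun M M' => rowSum M r = rowSum M' r) ?_ (fun _ => rfl)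
    (fun _ _ h => h.symm) (fun _ _ _ h h' => h.trans h') h
  intro i M M' h
  obtain ⟨s, _, e⟩ := lowers_iff.1 h
  have hi := i.2
  have h0 : ∑ c ∈ range m, rowMove i s r c = 0 := by
    by_cases hr : r = s
    · simp only [rowMove, if_pos hr, sum_sub_distrib, sum_ite_eq', mem_range]
      rw [if_pos (by omega), if_pos (by omega), sub_self]
    · simp [rowMove, hr]
  simp only [rowSum, e, sum_add_distrib, h0, add_zero]

lemma FirstMaxAfter.exists_raises {M : Fin n → Fin m → Bool} {i : Fin (m - 1)} {s : ℕ}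
    (hs : FirstMaxAfter (rowHeight (entry M) i) s) : ∃ M', Lowers i M' M := by
  have h1 := hs.1 s le_rfl
  have hsn : s < n := by
    by_contra hsn
    rw [rowHeight_of_ge M i (by omega : n ≤ s + 1), rowHeight_of_ge M i (not_lt.1 hsn)] at h1
    omega
  rw [rowHeight_succ] at h1
  have h2 := entry_eq_zero_or_one M s i
  have h3 := entry_eq_zero_or_one M s (i + 1)
  have h4 := entry_update_swap M i ⟨s, hsn⟩
  have h5 : entry M s i - entry M s (i + 1) = -1 := by omega
  simp only [h5] at h4
  exact ⟨_, e_eq_some_iff.1 ((binCrystal_e_eq_some _ _ i).2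
    ⟨s, hs, fun r c => by rw [h4]; ring⟩)⟩

/-- A walk that becomes positive reaches its maximum for the first time after an up-step, and a
raising operator applies there. -/
lemma RowHigh.rowHeight_nonpos {M : Fin n → Fin m → Bool} (h : RowHigh M) (i : Fin (m - 1))
    (t : ℕ) : rowHeight (entry M) i t ≤ 0 := by
  by_contra ht
  rw [not_le] at ht
  have hex : ∃ t, ∀ u, rowHeight (entry M) i u ≤ rowHeight (entry M) i t := by
    obtain ⟨t, _, ht⟩ := exists_max_image (range (n + 1)) (rowHeight (entry M) i) ⟨0, by simp⟩
    refine ⟨t, fun u => ?_⟩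
    rcases Nat.lt_or_ge u n with hu | hu
    · exact ht u (by rw [mem_range]; omega)
    · rw [rowHeight_of_ge M i hu]
      exact ht n (by simp)
  classical
  have hmax := Nat.find_spec hex
  have hmin := fun u (hu : u < Nat.find hex) => Nat.find_min hex hu
  generalize Nat.find hex = k at hmax hmin
  have hk : k ≠ 0 := by
    rintro rfl
    have := hmax t
    rw [rowHeight_zero] at this
    omega
  obtain ⟨s, rfl⟩ := Nat.exists_eq_succ_of_ne_zero hk
  have hs : FirstMaxAfter (rowHeight (entry M) i) s := by
    refine ⟨fun u hu => ?_, fun u _ => hmax u⟩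
    have := hmin u (by omega)
    push Not at this
    obtain ⟨v, hv⟩ := this
    exact lt_of_lt_of_le hv (hmax v)
  obtain ⟨M', hM'⟩ := hs.exists_raises
  exact h _ _ hM'

/-- The ballot conditions in both directions force the ones to be left-justified in each row, with
supports growing downwards. The induction adds one row at a time, using the shape of the rows above.
-/
lemma closed_of_height_nonpos {y : ℕ → ℕ → ℤ} (hy : ∀ a b, y a b = 0 ∨ y a b = 1) {m : ℕ}
    (hrow : ∀ b t, rowHeight y b t ≤ 0) (hcol : ∀ a, a + 1 < m → ∀ t, colHeight y a t ≤ 0)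
    {a : ℕ} (ha : a < m) :
    ∀ b, (y a (b + 1) = 1 → y a b = 1) ∧ ∀ a' ≤ a, y a' b = 1 → y a b = 1 := by
  induction a with
  | zero =>
    intro b
    refine ⟨fun h => ?_, fun a' ha' h => ?_⟩
    · have := hrow b 1
      rw [rowHeight_succ, rowHeight_zero, h] at this
      have := hy 0 b
      omega
    · rwa [Nat.le_zero.1 ha'] at h
  | succ a ih =>
    have ih := ih (by omega)
    have hdown : ∀ b, y a b = 1 → ∀ b' ≤ b, y a b' = 1 := by
      intro b
      induction b with
      | zero => intro h b' hb'; rwa [Nat.le_zero.1 hb']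
      | succ b ihb =>
        intro h b' hb'
        rcases hb'.lt_or_eq with hlt | rfl
        · exact ihb ((ih b).1 h) b' (by omega)
        · exact h
    have hstep : ∀ b, y a b = 1 → y (a + 1) b = 1 := by
      intro b hb
      have h1 := hcol a ha (b + 1)
      -- Row `a` is full up to column `b`, so all summands are nonnegative; the height being at most
      -- 0, each of them vanishes.
      have h2 : y a b - y (a + 1) b ≤ colHeight y a (b + 1) := by
        refine single_le_sum (f := fun k => y a k - y (a + 1) k) (fun k hk => ?_)
          (self_mem_range_succ b)
        rw [mem_range] at hk
        have h3 := hdown b hb k (by omega)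
        have h4 := hy (a + 1) k
        omega
      have h3 := hy (a + 1) b
      omega
    intro b
    refine ⟨fun h => ?_, fun a' ha' h => ?_⟩
    · by_cases hb : y a b = 1
      · exact hstep b hb
      · have h1 := hrow b (a + 2)
        rw [rowHeight_succ, h] at h1
        -- Column `b` is empty in the rows above, so a one in column `b + 1` must be compensated in
        -- the same row.
        have h2 : 0 ≤ rowHeight y b (a + 1) := by
          refine sum_nonneg fun a' ha' => ?_
          rw [mem_range] at ha'
          have h3 : y a' b ≠ 1 := fun h' => hb ((ih b).2 a' (by omega) h')
          have h4 := hy a' b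
          have h5 := hy a' (b + 1)
          omega
        have h3 := hy (a + 1) b
        omega
    · rcases ha'.lt_or_eq with hlt | rfl
      · exact hstep b ((ih b).2 a' (by omega) h)
      · exact h

lemma eq_one_iff_lt_sum {g : ℕ → ℤ} (hg : ∀ c, g c = 0 ∨ g c = 1) {m : ℕ}
    (hd : ∀ c, c + 1 < m → g (c + 1) = 1 → g c = 1) {c : ℕ} (hc : c < m) :
    g c = 1 ↔ (c : ℤ) < ∑ k ∈ range m, g k := by
  induction m with
  | zero => omega
  | succ m ih =>
    rw [sum_range_succ]
    have hle : ∑ k ∈ range m, g k ≤ m := by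
      calc ∑ k ∈ range m, g k ≤ ∑ k ∈ range m, 1 :=
            sum_le_sum fun k _ => by rcases hg k with h | h <;> omega
        _ = m := by simp
    have hall : g m = 1 → ∀ k ≤ m, g k = 1 := by
      intro h k hk
      induction hk using Nat.decreasingInduction with
      | self => exact h
      | of_succ k hk ih => exact hd k (by omega) ih
    rcases Nat.lt_succ_iff_lt_or_eq.1 hc with hc | rfl
    · rw [ih (fun c h => hd c (by omega)) hc]
      rcases hg m with h | h
      · rw [h, add_zero]
      · have : ∑ k ∈ range m, g k = m := by
          rw [sum_congr rfl fun k hk => hall h k (mem_range.1 hk).le]; simp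
        omega
    · rcases hg c with h | h
      · rw [h]; omega
      · have : ∑ k ∈ range c, g k = c := by
          rw [sum_congr rfl fun k hk => hall h k (mem_range.1 hk).le]; simp
        omega

lemma rot_closed_of_high {M : Fin n → Fin m → Bool} (h : RowHigh M) (h' : RowHigh (rot M))
    {a : ℕ} (ha : a < m) (b : ℕ) :
    (entry (rot M) a (b + 1) = 1 → entry (rot M) a b = 1) ∧
      ∀ a' ≤ a, entry (rot M) a' b = 1 → entry (rot M) a b = 1 := by
  refine closed_of_height_nonpos (entry_eq_zero_or_one _) (fun b t => ?_) (fun a ha t => ?_) ha b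
  · by_cases hb : b < n - 1
    · exact h'.rowHeight_nonpos ⟨b, hb⟩ t
    · refine sum_nonpos fun s _ => ?_
      rw [entry_col_ge _ _ (by omega : n ≤ b + 1)]
      have := entry_eq_zero_or_one (rot M) s b
      omega
  · have := colHeight_rot M ⟨a, by omega⟩ t
    simp only at this
    rw [this]
    exact h.rowHeight_nonpos _ t

/-- A matrix of highest weight for both crystals is a Young diagram in the upper left corner. -/
lemma entry_eq_one_iff_of_high {M : Fin n → Fin m → Bool} (h : RowHigh M) (h' : RowHigh (rot M))
    (r : ℕ) {c : ℕ} (hc : c < m) : entry M r c = 1 ↔ (c : ℤ) < rowSum M r := by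
  refine eq_one_iff_lt_sum (entry_eq_zero_or_one M r) (fun c hc hM => ?_) hc
  have h1 := (rot_closed_of_high h h' (a := m - 1 - c) (by omega) r).2 (m - 1 - (c + 1)) (by omega)
  rw [entry_rot _ _ (by omega), entry_rot _ _ (by omega)] at h1
  have e1 : m - 1 - (m - 1 - (c + 1)) = c + 1 := by omega
  have e2 : m - 1 - (m - 1 - c) = c := by omega
  rw [e1, e2] at h1
  exact h1 hM

lemma entry_eq_of_one_iff {n' m' : ℕ} {M : Fin n → Fin m → Bool} {N : Fin n' → Fin m' → Bool}
    {r c r' c' : ℕ} (h : entry M r c = 1 ↔ entry N r' c' = 1) : entry M r c = entry N r' c' := by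
  have h1 := entry_eq_zero_or_one M r c
  have h2 := entry_eq_zero_or_one N r' c'
  omega

lemma eq_of_high_of_rowSum {M N : Fin n → Fin m → Bool} (hM : RowHigh M) (hM' : RowHigh (rot M))
    (hN : RowHigh N) (hN' : RowHigh (rot N)) (h : ∀ r, rowSum M r = rowSum N r) : M = N := by
  refine entry_injective fun r c => ?_
  by_cases hc : c < m
  · apply entry_eq_of_one_iff
    rw [entry_eq_one_iff_of_high hM hM' r hc, entry_eq_one_iff_of_high hN hN' r hc, h]
  · rw [entry_col_ge _ _ (not_lt.1 hc), entry_col_ge _ _ (not_lt.1 hc)]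

/-- In a `gl_m`-component of `gl_n`-highest weight, the lowest element is the mirror image of the
highest one. -/
lemma eq_flip_of_rowConn {M N : Fin n → Fin m → Bool} (hM : RowHigh M) (hM' : RowHigh (rot M))
    (hN : RowLow N) (hN' : RowHigh (rot N)) (h : RowConn M N) : N = fun r c => M r c.rev := by
  funext r c
  have hc := c.2
  have h1 := entry_eq_one_iff_of_high hM hM' r c.rev.2
  -- `N` turned by 180 degrees is `gl_m`-highest while `N` is `gl_n`-highest, so the diagram
  -- argument applied to `rot N` makes the rows of `N` right-justified.
  have h2 : entry N r c = 1 ↔ ((c.rev : ℕ) : ℤ) < rowSum N r := by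
    have hd : ∀ a, a + 1 < m → entry N r (m - 1 - (a + 1)) = 1 → entry N r (m - 1 - a) = 1 := by
      intro a ha hN1
      have hr := r.2
      have h3 := (rot_closed_of_high hN' hN.rot_rot (a := n - 1 - r) (by omega) a).1
      have e : n - 1 - (n - 1 - (r : ℕ)) = r := by omega
      rw [entry_rot (rot N) (a + 1) (by omega), entry_rot (rot N) a (by omega), e,
        entry_rot _ _ ha, entry_rot _ _ (by omega)] at h3
      exact h3 hN1
    have h3 := eq_one_iff_lt_sum (g := fun k => entry N r (m - 1 - k))
      (fun k => entry_eq_zero_or_one _ _ _) hd c.rev.2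
    rw [sum_range_reflect] at h3
    have e : m - 1 - (c.rev : ℕ) = c := by rw [Fin.val_rev]; omega
    simp only [e] at h3
    exact h3
  rw [← h.rowSum_eq, ← h1, entry_val, entry_val] at h2
  cases hx : N r c <;> cases hy : M r c.rev <;> simp_all

end corners

/-! ### Highest elements, bicomponents and the involution -/

section involution

variable {n m : ℕ}

/-- The sum of the column indices of the ones of a matrix. -/
def colIndexSum (M : Fin n → Fin m → Bool) : ℤ :=
  ∑ r ∈ range n, ∑ c ∈ range m, c * entry M r c

lemma colIndexSum_nonneg (M : Fin n → Fin m → Bool) : 0 ≤ colIndexSum M := by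
  refine sum_nonneg fun r _ => sum_nonneg fun c _ => mul_nonneg (by positivity) ?_
  rcases entry_eq_zero_or_one M r c with h | h <;> omega

lemma Lowers.colIndexSum_eq {i : Fin (m - 1)} {M M' : Fin n → Fin m → Bool} (h : Lowers i M M') :
    colIndexSum M' = colIndexSum M + 1 := by
  obtain ⟨s, hs, e⟩ := lowers_iff.1 h
  have hi := i.2
  have h0 : ∀ r, ∑ c ∈ range m, (c : ℤ) * rowMove i s r c = if r = s then 1 else 0 := by
    intro r
    by_cases hr : r = s
    · simp only [rowMove, if_pos hr, mul_sub, sum_sub_distrib, mul_ite, mul_one, mul_zero,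
        sum_ite_eq', mem_range]
      rw [if_pos (by omega), if_pos (by omega)]
      push_cast; ring
    · simp [rowMove, hr]
  simp only [colIndexSum, e, mul_add, sum_add_distrib, h0, sum_ite_eq', mem_range, hs.row_lt,
    if_true]

/-- Raising lowers the nonnegative integer `colIndexSum` by one, so it terminates. -/
lemma raise_induction {p : (Fin n → Fin m → Bool) → Prop}
    (h : ∀ M, (∀ i M', Lowers i M' M → p M') → p M) (M : Fin n → Fin m → Bool) : p M := by
  induction hk : (colIndexSum M).toNat using Nat.strong_induction_on generalizing M with
  | _ k ih =>
    refine h M fun i M' hM' => ih _ ?_ M' rfl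
    have h1 := hM'.colIndexSum_eq
    have h2 := colIndexSum_nonneg M'
    omega

lemma exists_rowHigh (M : Fin n → Fin m → Bool) : ∃ N, RowConn M N ∧ RowHigh N := by
  refine raise_induction (p := fun M => ∃ N, RowConn M N ∧ RowHigh N) (fun M ih => ?_) M
  by_cases h : ∃ i M', Lowers i M' M
  · obtain ⟨i, M', h⟩ := h
    obtain ⟨N, hN, hN'⟩ := ih i M' h
    exact ⟨N, h.rowConn.symm.trans hN, hN'⟩
  · push Not at h
    exact ⟨M, .refl M, h⟩

lemma exists_rowLow (M : Fin n → Fin m → Bool) : ∃ N, RowConn M N ∧ RowLow N := by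
  obtain ⟨N, hN, hN'⟩ := exists_rowHigh (rot (rot M))
  refine ⟨rot (rot N), ?_, hN'.rot_rot⟩
  have := hN.rot_rot
  rwa [rot_four] at this

/-- A `gl_m`-component has only one element of highest weight. -/
lemma RowHigh.eq_of_rowConn {M N : Fin n → Fin m → Bool} (hM : RowHigh M) (hN : RowHigh N)
    (h : RowConn M N) : M = N := by
  -- Both matrices are raised in parallel by `gl_n`-operators, which keeps them `gl_m`-highest and
  -- `gl_m`-connected, until they are doubly highest and have equal row sums.
  have key : ∀ P : Fin m → Fin n → Bool, ∀ N, RowHigh (rotInv P) → RowHigh N →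
      RowConn (rotInv P) N → rotInv P = N := by
    refine raise_induction fun P ih N hP hN h => ?_
    by_cases hex : ∃ j P', Lowers j P' P
    · obtain ⟨j, P', hj⟩ := hex
      have hj' : Lowers j (rot (rotInv P')) (rot (rotInv P)) := by simpa using hj
      obtain ⟨N', hN', hc⟩ := h.transport_rot.2 j _ hj'
      have := ih j P' hj N' (hP.of_rowConn_rot hj'.rowConn.symm)
        (hN.of_rowConn_rot hN'.rowConn.symm) hc
      rw [this] at hj'
      exact rot_injective (hj'.unique_right hN')
    · push Not at hex
      have hP' : RowHigh (rot (rotInv P)) := by rw [rot_rotInv]; exact hex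
      exact eq_of_high_of_rowSum hP hP' hN (hP'.rot_of_rowConn h) h.rowSum_eq
  have := key (rot M) N
  rw [rotInv_rot] at this
  exact this hM hN h

/-- A `gl_m`-component and a `gl_n`-component have at most one common element. -/
lemma RowConn.eq_of_rot {M N : Fin n → Fin m → Bool} (h : RowConn M N)
    (h' : RowConn (rot M) (rot N)) : M = N := by
  refine raise_induction (p := fun M => ∀ N, RowConn M N → RowConn (rot M) (rot N) → M = N)
    (fun M ih N h h' => ?_) M N h h'
  by_cases hex : ∃ i M', Lowers i M' M
  · obtain ⟨i, M', hi⟩ := hex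
    obtain ⟨N', hN', hc⟩ := h'.transport_raises hi
    have := ih i M' hi N' ((hi.rowConn.trans h).trans hN'.rowConn.symm) hc
    rw [this] at hi
    exact hi.unique_right hN'
  · push Not at hex
    have hM : RowHigh M := hex
    -- At a `gl_m`-highest `M`, the `gl_n`-connected `N` is `gl_m`-highest too, so uniqueness in the
    -- `gl_m`-component applies.
    exact hM.eq_of_rowConn (hM.of_rowConn_rot h') h

/-- Being in the same component for the commuting `gl_m`- and `gl_n`-crystal structures. -/
def BiConn (M N : Fin n → Fin m → Bool) : Prop := ∃ P, RowConn M P ∧ RowConn (rot P) (rot N)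

lemma BiConn.symm {M N : Fin n → Fin m → Bool} (h : BiConn M N) : BiConn N M := by
  obtain ⟨P, h₁, h₂⟩ := h
  obtain ⟨Q, h₃, h₄⟩ := h₁.symm.exchange h₂
  exact ⟨Q, h₄, h₃.symm⟩

lemma BiConn.trans {M N P : Fin n → Fin m → Bool} (h : BiConn M N) (h' : BiConn N P) :
    BiConn M P := by
  obtain ⟨Q, h₁, h₂⟩ := h
  obtain ⟨R, h₃, h₄⟩ := h'
  obtain ⟨S, h₅, h₆⟩ := h₃.exchange h₂.symm
  exact ⟨S, h₁.trans h₆, h₅.symm.trans h₄⟩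

lemma BiConn.rot_rot {M N : Fin n → Fin m → Bool} (h : BiConn M N) :
    BiConn (rot (rot M)) (rot (rot N)) := by
  obtain ⟨P, h₁, h₂⟩ := h
  exact ⟨_, h₁.rot_rot, h₂.rot_rot⟩

/-- `M` is joined to a doubly highest `T`, and `T` to its half turn by two mirror images: to the
`gl_m`-lowest `L`, then to the `gl_n`-lowest `S`. The half turn of the path from `M` to `T`
completes the chain. -/
lemma biConn_rot_rot (M : Fin n → Fin m → Bool) : BiConn M (rot (rot M)) := by
  obtain ⟨H, hMH, hH⟩ := exists_rowHigh M
  obtain ⟨T', hHT, hT'⟩ := exists_rowHigh (rot H)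
  obtain ⟨T, rfl⟩ : ∃ T, T' = rot T := ⟨_, (rot_rotInv T').symm⟩
  have hT : RowHigh T := hH.of_rowConn_rot hHT
  have hMT : BiConn M T := ⟨H, hMH, hHT⟩
  obtain ⟨L, hTL, hL⟩ := exists_rowLow T
  have hL' : RowHigh (rot L) := hT'.rot_of_rowConn hTL
  obtain ⟨S', hLS, hS'⟩ := exists_rowLow (rot L)
  obtain ⟨S, rfl⟩ : ∃ S, S' = rot S := ⟨_, (rot_rotInv S').symm⟩
  have hS : RowLow S := hL.of_rowConn_rot hLS
  have e₁ := eq_flip_of_rowConn hT hT' hL hL' hTL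
  have e₂ := eq_flip_of_rowConn hL' hL.rot_rot hS' hS.rot_rot hLS
  have e : S = rot (rot T) := by
    funext r c
    have := congrFun (congrFun e₂ c.rev) r
    simp only [rot, Fin.rev_rev, e₁] at this
    simpa [rot] using this
  have hTT : BiConn T (rot (rot T)) := ⟨L, hTL, by rwa [← e]⟩
  exact (hMT.trans hTT).trans hMT.rot_rot.symm

/-- The Schützenberger involution of the `gl_m`-crystal of `0/1`-matrices: the common element of
the `gl_m`-component of `M` and the `gl_n`-component of the matrix `M` turned by 180 degrees. -/
noncomputable def evac (M : Fin n → Fin m → Bool) : Fin n → Fin m → Bool :=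
  (biConn_rot_rot M).choose

lemma rowConn_evac (M : Fin n → Fin m → Bool) : RowConn M (evac M) :=
  (biConn_rot_rot M).choose_spec.1

lemma rowConn_rot_evac (M : Fin n → Fin m → Bool) :
    RowConn (rot (evac M)) (rot (rot (rot M))) :=
  (biConn_rot_rot M).choose_spec.2

lemma eq_evac {M N : Fin n → Fin m → Bool} (h : RowConn M N)
    (h' : RowConn (rot N) (rot (rot (rot M)))) : N = evac M :=
  (h.symm.trans (rowConn_evac M)).eq_of_rot (h'.trans (rowConn_rot_evac M).symm)

/-- Skew Howe duality exchanges the Schützenberger involutions. -/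
lemma evac_rot_rot_rot (M : Fin n → Fin m → Bool) :
    evac (rot (rot (rot M))) = rot (evac M) := by
  refine (eq_evac (rowConn_rot_evac M).symm ?_).symm
  rw [show rot (rot (rot (rot (rot (rot M))))) = rot (rot M) by rw [rot_four]]
  exact (rowConn_evac M).symm.rot_rot

lemma wt_eq_rowSum_rot (M : Fin n → Fin m → Bool) (a : Fin m) :
    (binCrystal n m).wt M a = rowSum (rot M) a.rev := by
  have h : ∀ c, entry (rot M) a.rev c = entry M c a := by
    intro c
    rw [entry_rot _ _ a.rev.2]
    congr 1
    have := a.2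
    rw [Fin.val_rev]; omega
  simp only [rowSum, h, sum_range, entry_val, GLCrystalData.tensorPower, exteriorCrystal,
    Finset.sum_apply]

/-- A lowering of `M` is a raising of its half turn with reversed label, and this transports along
the `gl_n`-component to `evac M`. The result satisfies both conditions that characterise `evac` of
the lowered matrix. Weights are row sums of `rot M`, constant on `gl_n`-components and reversed by
the half turn. -/
theorem isFullSchutzenberger_evac :
    (binCrystal n m).IsFullSchutzenberger evac where
  component := rowConn_evac
  e_comm i _ M := by
    cases hf : (binCrystal n m).f i.rev M with
    | none =>
      rw [Option.map_none, Option.eq_none_iff_forall_ne_some]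
      intro N hN
      rw [e_eq_some_iff] at hN
      obtain ⟨P, hP, _⟩ := (rowConn_rot_evac M).transport_raises hN
      rw [← rot_rotInv P, ← rot_rotInv (rotInv P), lowers_rot_rot_iff] at hP
      exact absurd (hP.symm.trans hf) (by simp)
    | some M₁ =>
      have hM₁ : Lowers i (rot (rot M₁)) (rot (rot M)) := by rwa [lowers_rot_rot_iff]
      obtain ⟨N, hN, hc⟩ := (rowConn_rot_evac M).symm.transport_raises hM₁
      rw [Option.map_some, e_eq_some_iff]
      have hf' : Lowers i.rev M M₁ := hf
      rwa [← eq_evac ((hf'.rowConn.symm.trans (rowConn_evac M)).trans hN.rowConn.symm) hc.symm]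
  f_comm i _ M := by
    cases he : (binCrystal n m).e i.rev M with
    | none =>
      rw [Option.map_none, Option.eq_none_iff_forall_ne_some]
      intro N hN
      obtain ⟨P, hP, _⟩ := (rowConn_rot_evac M).transport_lowers hN
      rw [← rot_rotInv P, ← rot_rotInv (rotInv P), lowers_rot_rot_iff, ← e_eq_some_iff] at hP
      exact absurd (hP.symm.trans he) (by simp)
    | some M₁ =>
      rw [e_eq_some_iff] at he
      have hM₁ : Lowers i (rot (rot M)) (rot (rot M₁)) := by rwa [lowers_rot_rot_iff]
      obtain ⟨N, hN, hc⟩ := (rowConn_rot_evac M).symm.transport_lowers hM₁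
      rw [Option.map_some]
      rwa [← eq_evac ((he.rowConn.trans (rowConn_evac M)).trans hN.rowConn) hc.symm]
  wt_comm M a := by
    rw [wt_eq_rowSum_rot, wt_eq_rowSum_rot, (rowConn_rot_evac M).rowSum_eq]
    have ha := a.2
    simp only [rowSum]
    rw [← sum_range_reflect]
    refine sum_congr rfl fun k hk => ?_
    rw [mem_range] at hk
    rw [entry_rot _ _ a.rev.2, entry_rot _ _ (by omega), entry_rot _ _ (by omega),
      entry_rot _ _ a.rev.rev.2]
    simp only [Fin.val_rev]
    congr 1 <;> omega

end involution

/-! ### Uniqueness and transport of Schützenberger involutions -/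

namespace GLCrystalData

variable {k : ℕ} {B : Type}

/-- A Schützenberger involution is unique if every component has only one element of highest
weight. -/
lemma IsSchutzenberger.eq_of_unique_highest {C : GLCrystalData k B} {J : Set (Fin (k - 1))}
    {θ : Fin (k - 1) → Fin (k - 1)} {w : Fin k → Fin k} (hθ : ∀ i ∈ J, θ i ∈ J)
    (hθθ : ∀ i ∈ J, θ (θ i) = i)
    (hef : ∀ i ∈ J, ∀ b b', C.e i b' = some b → C.f i b = some b')
    (hind : ∀ p : B → Prop, (∀ b, (∀ i ∈ J, ∀ b', C.f i b = some b' → p b') → p b) → ∀ b, p b)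
    (huniq : ∀ b b', (∀ i ∈ J, C.e i b = none) → (∀ i ∈ J, C.e i b' = none) →
      C.SameComponent J b b' → b = b')
    {ξ ξ' : B → B} (h : C.IsSchutzenberger J θ w ξ) (h' : C.IsSchutzenberger J θ w ξ') :
    ξ = ξ' := by
  funext b
  refine hind (fun b => ξ b = ξ' b) (fun b ih => ?_) b
  by_cases hex : ∃ i ∈ J, ∃ b', C.f i b = some b'
  · obtain ⟨i, hi, b', hb⟩ := hex
    have h1 := h.e_comm (θ i) (hθ i hi) b
    have h2 := h'.e_comm (θ i) (hθ i hi) b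
    rw [hθθ i hi, hb, Option.map_some] at h1 h2
    -- Both images of `b` arise from the images of `b'` by the same lowering operator, so agreement
    -- at `b'` passes to `b`.
    have h3 := hef _ (hθ i hi) _ _ h1
    have h4 := hef _ (hθ i hi) _ _ h2
    rw [ih i hi b' hb] at h3
    exact Option.some_injective _ (h3.symm.trans h4)
  · have hnone : ∀ i ∈ J, C.f i b = none := fun i hi =>
      Option.eq_none_iff_forall_ne_some.2 fun b' hb => hex ⟨i, hi, b', hb⟩
    refine huniq _ _ (fun i hi => ?_) (fun i hi => ?_)
      (Relation.EqvGen.trans _ _ _ (Relation.EqvGen.symm _ _ (h.component b)) (h'.component b))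
    · rw [h.e_comm i hi, hnone _ (hθ i hi), Option.map_none]
    · rw [h'.e_comm i hi, hnone _ (hθ i hi), Option.map_none]

end GLCrystalData

namespace GLCrystalData

variable {k : ℕ} {A B : Type}

lemma transport_transport_symm (C : GLCrystalData k B) (g : A ≃ B) :
    (C.transport g).transport g.symm = C := by
  cases C
  simp [transport, Option.map_map]

lemma SameComponent.transport {C : GLCrystalData k B} (g : A ≃ B) {J : Set (Fin (k - 1))}
    {b b' : B} (h : C.SameComponent J b b') :
    (C.transport g).SameComponent J (g.symm b) (g.symm b') := by
  induction h with
  | rel _ _ h =>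
    obtain ⟨i, hi, h⟩ := h
    exact .rel _ _ ⟨i, hi, by simp [GLCrystalData.transport, h]⟩
  | refl => exact .refl _
  | symm _ _ _ ih => exact .symm _ _ ih
  | trans _ _ _ _ _ ih₁ ih₂ => exact .trans _ _ _ ih₁ ih₂

lemma IsSchutzenberger.transport {C : GLCrystalData k B} (g : A ≃ B) {J : Set (Fin (k - 1))}
    {θ : Fin (k - 1) → Fin (k - 1)} {w : Fin k → Fin k} {ξ : B → B}
    (h : C.IsSchutzenberger J θ w ξ) :
    (C.transport g).IsSchutzenberger J θ w (g.symm ∘ ξ ∘ g) where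
  component a := by simpa using (h.component (g a)).transport g
  e_comm i hi a := by
    simp [GLCrystalData.transport, h.e_comm i hi, Function.comp_def]
  f_comm i hi a := by
    simp [GLCrystalData.transport, h.f_comm i hi, Function.comp_def]
  wt_comm a x := by simp [GLCrystalData.transport, h.wt_comm]

lemma existsUnique_isSchutzenberger_transport {C : GLCrystalData k B} (g : A ≃ B)
    {J : Set (Fin (k - 1))} {θ : Fin (k - 1) → Fin (k - 1)} {w : Fin k → Fin k}
    (h : ∃! ξ, C.IsSchutzenberger J θ w ξ) :
    ∃! ξ, (C.transport g).IsSchutzenberger J θ w ξ := by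
  obtain ⟨ξ, hξ, huniq⟩ := h
  refine ⟨_, hξ.transport g, fun ξ' hξ' => ?_⟩
  have h1 := hξ'.transport g.symm
  rw [transport_transport_symm] at h1
  have h2 := huniq _ h1
  funext a
  have := congrFun h2 (g a)
  simp only [Function.comp_apply, Equiv.symm_symm, Equiv.symm_apply_apply] at this
  simp [← this]

lemma schutzenberger_eq {C : GLCrystalData k B} (h : ∃! ξ, C.IsFullSchutzenberger ξ) {ξ : B → B}
    (hξ : C.IsFullSchutzenberger ξ) : C.schutzenberger = ξ := by
  have hex : ∃ ξ, C.IsFullSchutzenberger ξ := ⟨ξ, hξ⟩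
  rw [schutzenberger, dif_pos hex]
  exact h.unique hex.choose_spec hξ

lemma innerCactus_eq {C : GLCrystalData k B} {p q : Fin k}
    (h : ∃! ξ, C.IsIntervalSchutzenberger p q ξ) {ξ : B → B}
    (hξ : C.IsIntervalSchutzenberger p q ξ) : C.innerCactus p q = ξ := by
  have hex : ∃ ξ, C.IsIntervalSchutzenberger p q ξ := ⟨ξ, hξ⟩
  rw [innerCactus, dif_pos hex]
  exact h.unique hex.choose_spec hξ

end GLCrystalData

section uniqueness

variable {n m : ℕ}

lemma lower_induction {p : (Fin n → Fin m → Bool) → Prop}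
    (h : ∀ M, (∀ i M', Lowers i M M' → p M') → p M) (M : Fin n → Fin m → Bool) : p M := by
  have := raise_induction (p := fun M : Fin n → Fin m → Bool => p (rot (rot M)))
    (fun M ih => h _ fun i M' hM' => ?_) (rot (rot M))
  · rwa [rot_four] at this
  · rw [← rot_four M', lowers_rot_rot_iff] at hM'
    have := ih _ _ hM'
    rwa [rot_four] at this

lemma rowHigh_of_e_eq_none {M : Fin n → Fin m → Bool} (h : ∀ i, (binCrystal n m).e i M = none) :
    RowHigh M := by
  intro i M' hM'
  rw [← e_eq_some_iff, h i] at hM'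
  exact absurd hM' (by simp)

theorem existsUnique_isFullSchutzenberger :
    ∃! ξ, (binCrystal n m).IsFullSchutzenberger ξ := by
  refine ⟨evac, isFullSchutzenberger_evac, fun ξ hξ => ?_⟩
  refine GLCrystalData.IsSchutzenberger.eq_of_unique_highest (fun _ _ => Set.mem_univ _)
    (fun i _ => Fin.rev_rev i) (fun i _ b b' h => e_eq_some_iff.1 h) (fun p h b => ?_)
    (fun b b' hb hb' hc => ?_) hξ isFullSchutzenberger_evac
  · exact lower_induction (fun M ih => h M fun i _ => ih i) b
  · exact (rowHigh_of_e_eq_none fun i => hb i (Set.mem_univ i)).eq_of_rowConn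
      (rowHigh_of_e_eq_none fun i => hb' i (Set.mem_univ i)) hc

end uniqueness

/-! ### A single tensor factor -/

section exterior

variable {n : ℕ}

lemma exteriorCrystal_eq_transport (n : ℕ) : exteriorCrystal n =
    (binCrystal 1 n).transport (Equiv.funUnique (Fin 1) (Fin n → Bool)).symm := by
  have heps : ∀ i c, (exteriorCrystal n).tensorEpsAt (r := 1) i (fun _ => c) =
      fun _ => (exteriorCrystal n).eps i c := by
    intro i c; funext s
    have : Iio s = ∅ := by
      ext x; simp [Subsingleton.elim x s]
    simp [GLCrystalData.tensorEpsAt, this, corootPairing]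
  have hphi : ∀ i c, (exteriorCrystal n).tensorPhiAt (r := 1) i (fun _ => c) =
      fun _ => (exteriorCrystal n).phi i c := by
    intro i c; funext s
    have : Ioi s = ∅ := by
      ext x; simp [Subsingleton.elim x s]
    simp [GLCrystalData.tensorPhiAt, this, corootPairing]
  have heps' : ∀ i c, (exteriorCrystal n).tensorEps (r := 1) i (fun _ => c) =
      (exteriorCrystal n).eps i c := by
    intro i c
    rw [GLCrystalData.tensorEps, heps]
    simp only [univ_unique, fold_singleton, exteriorCrystal]
    split_ifs <;> rfl
  have hphi' : ∀ i c, (exteriorCrystal n).tensorPhi (r := 1) i (fun _ => c) =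
      (exteriorCrystal n).phi i c := by
    intro i c
    rw [GLCrystalData.tensorPhi, hphi]
    simp only [univ_unique, fold_singleton, exteriorCrystal]
    split_ifs <;> rfl
  have hg : ∀ c : Fin n → Bool, (Equiv.funUnique (Fin 1) (Fin n → Bool)).symm c = fun _ => c :=
    fun c => rfl
  have hupd : ∀ (c : Fin n → Bool) (s : Fin 1),
      (Equiv.funUnique (Fin 1) (Fin n → Bool)) ∘ Function.update (fun _ => c) s = id := by
    intro c s
    funext d
    simp [Subsingleton.elim s 0]
  have hmk : ∀ C D : GLCrystalData n (Fin n → Bool), C.e = D.e → C.f = D.f → C.eps = D.eps →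
      C.phi = D.phi → C.wt = D.wt → C = D := by
    rintro ⟨⟩ ⟨⟩ rfl rfl rfl rfl rfl; rfl
  apply hmk
  · funext i c
    simp only [GLCrystalData.transport, hg, binCrystal, GLCrystalData.tensorPower, heps, heps',
      filter_true, univ_nonempty, dif_pos, Option.map_map, Equiv.symm_symm, hupd, Option.map_id,
      id]
  · funext i c
    simp only [GLCrystalData.transport, hg, binCrystal, GLCrystalData.tensorPower, hphi, hphi',
      filter_true, univ_nonempty, dif_pos, Option.map_map, Equiv.symm_symm, hupd, Option.map_id,
      id]
  · funext i c
    simp only [GLCrystalData.transport, hg, binCrystal, GLCrystalData.tensorPower, heps']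
  · funext i c
    simp only [GLCrystalData.transport, hg, binCrystal, GLCrystalData.tensorPower, hphi']
  · funext c
    simp only [GLCrystalData.transport, hg, binCrystal, GLCrystalData.tensorPower, univ_unique,
      sum_singleton]

lemma RowConn.eq_of_one {M M' : Fin n → Fin 1 → Bool} (h : RowConn M M') : M = M' :=
  RowConn.induction (r := Eq) (fun i => i.elim0) (fun _ => rfl) (fun _ _ => Eq.symm)
    (fun _ _ _ => Eq.trans) h

/-- On the dual side is `gl_1`, which has no roots: its components are single points. -/
lemma evac_one_row (M : Fin 1 → Fin n → Bool) : evac M = rot (rot M) :=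
  rot_injective (rowConn_rot_evac M).eq_of_one

theorem existsUnique_isFullSchutzenberger_exteriorCrystal (n : ℕ) :
    ∃! ξ, (exteriorCrystal n).IsFullSchutzenberger ξ := by
  rw [exteriorCrystal_eq_transport]
  exact GLCrystalData.existsUnique_isSchutzenberger_transport _ existsUnique_isFullSchutzenberger

lemma schutzenberger_exteriorCrystal (c : Fin n → Bool) :
    (exteriorCrystal n).schutzenberger c = c ∘ Fin.rev := by
  have h := (isFullSchutzenberger_evac (n := 1) (m := n)).transport
    (Equiv.funUnique (Fin 1) (Fin n → Bool)).symm
  rw [← exteriorCrystal_eq_transport] at h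
  rw [GLCrystalData.schutzenberger_eq (existsUnique_isFullSchutzenberger_exteriorCrystal n) h]
  simp only [Function.comp_apply, evac_one_row]
  rfl

end exterior

/-! ### Restriction to a block of consecutive columns -/

section interval

variable {n m k p : ℕ}

/-- The columns `p, …, p + k - 1` of a matrix. -/
def colBlock (h : p + k ≤ m) (M : Fin n → Fin m → Bool) : Fin n → Fin k → Bool :=
  fun r c => M r ⟨p + c, by omega⟩

/-- Replace the columns `p, …, p + k - 1` of a matrix. -/
def setColBlock (p : ℕ) (M : Fin n → Fin m → Bool) (Y : Fin n → Fin k → Bool) :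
    Fin n → Fin m → Bool :=
  fun r c => if h : p ≤ c.val ∧ c.val < p + k then Y r ⟨c - p, by omega⟩ else M r c

lemma colBlock_setColBlock (h : p + k ≤ m) (M : Fin n → Fin m → Bool) (Y : Fin n → Fin k → Bool) :
    colBlock h (setColBlock p M Y) = Y := by
  funext r c
  simp [colBlock, setColBlock]

lemma setColBlock_setColBlock (M : Fin n → Fin m → Bool) (Y Z : Fin n → Fin k → Bool) :
    setColBlock p (setColBlock p M Y) Z = setColBlock p M Z := by
  funext r c
  simp only [setColBlock]
  split_ifs <;> rfl

lemma setColBlock_colBlock (h : p + k ≤ m) (M : Fin n → Fin m → Bool) :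
    setColBlock p M (colBlock h M) = M := by
  funext r c
  simp only [colBlock, setColBlock]
  split_ifs with hc
  · congr; omega
  · rfl

lemma entry_colBlock (h : p + k ≤ m) (M : Fin n → Fin m → Bool) (r : ℕ) {c : ℕ} (hc : c < k) :
    entry (colBlock h M) r c = entry M r (p + c) := by
  by_cases hr : r < n
  · rw [entry_of_lt _ hr hc, entry_of_lt _ hr (by omega)]
    rfl
  · rw [entry_row_ge _ _ (not_lt.1 hr), entry_row_ge _ _ (not_lt.1 hr)]

lemma entry_setColBlock (h : p + k ≤ m) (M : Fin n → Fin m → Bool) (Y : Fin n → Fin k → Bool)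
    (r c : ℕ) : entry (setColBlock p M Y) r c =
      if p ≤ c ∧ c < p + k then entry Y r (c - p) else entry M r c := by
  by_cases hr : r < n
  · by_cases hc : c < m
    · rw [entry_of_lt _ hr hc]
      by_cases hcp : p ≤ c ∧ c < p + k
      · rw [if_pos hcp, entry_of_lt _ hr (by omega)]
        simp [setColBlock, hcp]
      · rw [if_neg hcp, entry_of_lt _ hr hc]
        simp [setColBlock, hcp]
    · rw [if_neg (by omega), entry_col_ge _ _ (not_lt.1 hc), entry_col_ge _ _ (not_lt.1 hc)]
  · simp [entry_row_ge _ _ (not_lt.1 hr)]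

/-- The inclusion of the simple roots of `gl_k` as those of the columns `p, …, p + k - 1`. -/
def shiftRoot (h : p + k ≤ m) (i : Fin (k - 1)) : Fin (m - 1) := ⟨p + i, by omega⟩

lemma rowHeight_colBlock (h : p + k ≤ m) (M : Fin n → Fin m → Bool) (i : Fin (k - 1)) :
    rowHeight (entry (colBlock h M)) i = rowHeight (entry M) (shiftRoot h i) := by
  funext t
  refine sum_congr rfl fun s _ => ?_
  rw [entry_colBlock _ _ _ (by omega), entry_colBlock _ _ _ (by omega)]
  rfl

/-- The walk of root `i` and the resulting move involve only columns `i` and `i + 1`, both inside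
the block. -/
lemma lowers_setColBlock_iff (h : p + k ≤ m) {M : Fin n → Fin m → Bool}
    {Y : Fin n → Fin k → Bool} {i : Fin (k - 1)} :
    Lowers (shiftRoot h i) M (setColBlock p M Y) ↔ Lowers i (colBlock h M) Y := by
  rw [lowers_iff, lowers_iff]
  refine exists_congr fun s => and_congr (by rw [rowHeight_colBlock]) ?_
  have hi := i.2
  have hval : (shiftRoot h i : ℕ) = p + i := rfl
  constructor
  · intro e r c
    by_cases hc : c < k
    · have := e r (p + c)
      rw [entry_setColBlock h, if_pos (by omega), Nat.add_sub_cancel_left] at this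
      rw [entry_colBlock _ _ _ hc, this]
      simp only [rowMove, hval]
      split_ifs <;> omega
    · rw [entry_col_ge _ _ (not_lt.1 hc), entry_col_ge _ _ (not_lt.1 hc)]
      simp only [rowMove]
      split_ifs <;> omega
  · intro e r c
    rw [entry_setColBlock h]
    by_cases hc : p ≤ c ∧ c < p + k
    · rw [if_pos hc, e, entry_colBlock _ _ _ (by omega), Nat.add_sub_cancel' hc.1]
      simp only [rowMove, hval]
      split_ifs <;> omega
    · rw [if_neg hc]
      simp only [rowMove, hval]
      split_ifs <;> omega

lemma Lowers.eq_setColBlock (h : p + k ≤ m) {M M' : Fin n → Fin m → Bool} {i : Fin (k - 1)}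
    (hM : Lowers (shiftRoot h i) M M') : M' = setColBlock p M (colBlock h M') := by
  obtain ⟨s, _, e⟩ := lowers_iff.1 hM
  refine entry_injective fun r c => ?_
  rw [entry_setColBlock h]
  split_ifs with hc
  · rw [entry_colBlock _ _ _ (by omega), Nat.add_sub_cancel' hc.1]
  · rw [e]
    have hi := i.2
    have hval : (shiftRoot h i : ℕ) = p + i := rfl
    simp only [rowMove, hval]
    split_ifs <;> omega

lemma f_shiftRoot (h : p + k ≤ m) (M : Fin n → Fin m → Bool) (i : Fin (k - 1)) :
    (binCrystal n m).f (shiftRoot h i) M =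
      ((binCrystal n k).f i (colBlock h M)).map (setColBlock p M) := by
  ext M'
  rw [Option.map_eq_some_iff]
  constructor
  · intro hM
    have e := Lowers.eq_setColBlock h hM
    refine ⟨colBlock h M', (lowers_setColBlock_iff h).1 ?_, e.symm⟩
    rw [← e]; exact hM
  · rintro ⟨Y, hY, rfl⟩
    exact (lowers_setColBlock_iff h).2 hY

lemma e_shiftRoot (h : p + k ≤ m) (M : Fin n → Fin m → Bool) (i : Fin (k - 1)) :
    (binCrystal n m).e (shiftRoot h i) M =
      ((binCrystal n k).e i (colBlock h M)).map (setColBlock p M) := by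
  ext M'
  rw [Option.map_eq_some_iff, e_eq_some_iff]
  constructor
  · intro hM
    have e := Lowers.eq_setColBlock h hM
    refine ⟨colBlock h M', ?_, ?_⟩
    · rw [e_eq_some_iff, ← lowers_setColBlock_iff h, ← e]
      exact hM
    · rw [e, setColBlock_setColBlock, setColBlock_colBlock]
  · rintro ⟨Y, hY, rfl⟩
    rw [e_eq_some_iff, ← colBlock_setColBlock h M Y, ← lowers_setColBlock_iff h,
      setColBlock_setColBlock, setColBlock_colBlock] at hY
    exact hY

end interval

/-! ### Interval involutions and comparison of the two actions -/

section intervalInvolution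

open GLCrystalData

variable {n m k : ℕ} {p q : Fin m}

lemma mem_intervalRoots_iff (hk : p.val + k = q.val + 1) (h : p.val + k ≤ m) {i : Fin (m - 1)} :
    i ∈ intervalRoots p q ↔ ∃ i' : Fin (k - 1), i = shiftRoot h i' := by
  constructor
  · rintro ⟨h1, h2⟩
    exact ⟨⟨i - p, by omega⟩, Fin.ext (by simp [shiftRoot]; omega)⟩
  · rintro ⟨i', rfl⟩
    have := i'.2
    exact ⟨Nat.le_add_right _ _, by simp only [shiftRoot]; omega⟩

lemma intervalTheta_shiftRoot (hk : p.val + k = q.val + 1) (h : p.val + k ≤ m)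
    (i : Fin (k - 1)) : intervalTheta p q (shiftRoot h i) = shiftRoot h i.rev := by
  have hi := i.2
  have : p.val ≤ (shiftRoot h i).val ∧ (shiftRoot h i).val < q.val :=
    (mem_intervalRoots_iff hk h).2 ⟨i, rfl⟩
  rw [intervalTheta, dif_pos this]
  ext
  simp only [shiftRoot, Fin.val_rev]
  omega

lemma wt_setColBlock (M : Fin n → Fin m → Bool) (Y : Fin n → Fin k → Bool)
    (a : Fin m) : (binCrystal n m).wt (setColBlock p M Y) a =
      if h : p.val ≤ a.val ∧ a.val < p.val + k then (binCrystal n k).wt Y ⟨a - p, by omega⟩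
      else (binCrystal n m).wt M a := by
  simp only [binCrystal, tensorPower, exteriorCrystal, Finset.sum_apply, setColBlock]
  split_ifs <;> rfl

lemma wt_colBlock (h : p.val + k ≤ m) (M : Fin n → Fin m → Bool) (a : Fin k) :
    (binCrystal n k).wt (colBlock h M) a = (binCrystal n m).wt M ⟨p + a, by omega⟩ := by
  simp only [binCrystal, tensorPower, exteriorCrystal, Finset.sum_apply, colBlock]
  rfl

theorem isIntervalSchutzenberger_setColBlock_evac (hk : p.val + k = q.val + 1)
    (h : p.val + k ≤ m) : (binCrystal n m).IsIntervalSchutzenberger p q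
      fun M => setColBlock p M (evac (colBlock h M)) where
  component M := by
    have key : ∀ Y Y' : Fin n → Fin k → Bool, RowConn Y Y' →
        (binCrystal n m).SameComponent (intervalRoots p q) (setColBlock p M Y)
          (setColBlock p M Y') := by
      intro Y Y' hY
      refine RowConn.induction (r := fun Y Y' =>
        (binCrystal n m).SameComponent (intervalRoots p q) (setColBlock p M Y)
          (setColBlock p M Y')) ?_ (fun _ => .refl _) (fun _ _ => .symm _ _)
          (fun _ _ _ => .trans _ _ _) hY
      intro i Y Y' hY
      refine .rel _ _ ⟨shiftRoot h i, (mem_intervalRoots_iff hk h).2 ⟨i, rfl⟩, ?_⟩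
      rw [← colBlock_setColBlock h M Y, ← lowers_setColBlock_iff h,
        setColBlock_setColBlock] at hY
      exact hY
    have := key _ _ (rowConn_evac (colBlock h M))
    rwa [setColBlock_colBlock] at this
  e_comm i hi M := by
    obtain ⟨i, rfl⟩ := (mem_intervalRoots_iff hk h).1 hi
    rw [intervalTheta_shiftRoot hk h, e_shiftRoot, f_shiftRoot, colBlock_setColBlock,
      isFullSchutzenberger_evac.e_comm i (Set.mem_univ i), Option.map_map, Option.map_map]
    congr 1
    funext Y
    simp only [Function.comp_apply, colBlock_setColBlock, setColBlock_setColBlock]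
  f_comm i hi M := by
    obtain ⟨i, rfl⟩ := (mem_intervalRoots_iff hk h).1 hi
    rw [intervalTheta_shiftRoot hk h, e_shiftRoot, f_shiftRoot, colBlock_setColBlock,
      isFullSchutzenberger_evac.f_comm i (Set.mem_univ i), Option.map_map, Option.map_map]
    congr 1
    funext Y
    simp only [Function.comp_apply, colBlock_setColBlock, setColBlock_setColBlock]
  wt_comm M a := by
    rw [wt_setColBlock]
    by_cases ha : p.val ≤ a.val ∧ a.val < p.val + k
    · rw [dif_pos ha, isFullSchutzenberger_evac.wt_comm, wt_colBlock, intervalRev,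
        dif_pos (by omega)]
      congr 1
      ext
      simp only [Fin.val_rev]
      omega
    · rw [dif_neg ha, intervalRev, dif_neg (by omega)]

/-- The second conclusion says that `M` and `M'` agree outside the block; with the first it reduces
uniqueness of highest elements for the interval to that for `gl_k`. -/
lemma rowConn_colBlock (hk : p.val + k = q.val + 1) (h : p.val + k ≤ m)
    {M M' : Fin n → Fin m → Bool}
    (hM : (binCrystal n m).SameComponent (intervalRoots p q) M M') :
    RowConn (colBlock h M) (colBlock h M') ∧ ∀ Y : Fin n → Fin k → Bool,
      setColBlock p M Y = setColBlock p M' Y := by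
  induction hM with
  | rel M M' hM =>
    obtain ⟨i, hi, hM⟩ := hM
    obtain ⟨i, rfl⟩ := (mem_intervalRoots_iff hk h).1 hi
    have e := Lowers.eq_setColBlock h hM
    constructor
    · refine Lowers.rowConn (i := i) ?_
      rw [← lowers_setColBlock_iff h, ← e]
      exact hM
    · intro Y
      rw [e, setColBlock_setColBlock]
  | refl => exact ⟨.refl _, fun _ => rfl⟩
  | symm _ _ _ ih => exact ⟨ih.1.symm, fun Y => (ih.2 Y).symm⟩
  | trans _ _ _ _ _ ih₁ ih₂ => exact ⟨ih₁.1.trans ih₂.1, fun Y => (ih₁.2 Y).trans (ih₂.2 Y)⟩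

theorem existsUnique_isIntervalSchutzenberger (hpq : p < q) :
    ∃! ξ, (binCrystal n m).IsIntervalSchutzenberger p q ξ := by
  obtain ⟨k, hk⟩ : ∃ k, p.val + k = q.val + 1 := ⟨q + 1 - p, by omega⟩
  have h : p.val + k ≤ m := by omega
  have hξ := isIntervalSchutzenberger_setColBlock_evac (n := n) hk h
  refine ⟨_, hξ, fun ξ' hξ' => ?_⟩
  refine IsSchutzenberger.eq_of_unique_highest (fun i hi => ?_) (fun i hi => ?_)
    (fun i _ b b' h => e_eq_some_iff.1 h) (fun P hP b => ?_) (fun b b' hb hb' hc => ?_) hξ' hξ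
  · obtain ⟨i, rfl⟩ := (mem_intervalRoots_iff hk h).1 hi
    rw [intervalTheta_shiftRoot hk h]
    exact (mem_intervalRoots_iff hk h).2 ⟨_, rfl⟩
  · obtain ⟨i, rfl⟩ := (mem_intervalRoots_iff hk h).1 hi
    rw [intervalTheta_shiftRoot hk h, intervalTheta_shiftRoot hk h, Fin.rev_rev]
  · exact lower_induction (fun M ih => hP M fun i _ => ih i) b
  · have hhigh : ∀ b : Fin n → Fin m → Bool,
        (∀ i ∈ intervalRoots p q, (binCrystal n m).e i b = none) → RowHigh (colBlock h b) := by
      intro b hb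
      refine rowHigh_of_e_eq_none fun i => ?_
      have := hb _ ((mem_intervalRoots_iff hk h).2 ⟨i, rfl⟩)
      rwa [e_shiftRoot, Option.map_eq_none_iff] at this
    obtain ⟨hconn, hset⟩ := rowConn_colBlock hk h hc
    rw [← setColBlock_colBlock h b, (hhigh b hb).eq_of_rowConn (hhigh b' hb') hconn, hset,
      setColBlock_colBlock]

lemma rowCrystal_eq_transport (n m : ℕ) :
    rowCrystal n m = (binCrystal n m).transport (rowTensor n m) := rfl

lemma innerAction_eq (hpq : p < q) (hk : p.val + k = q.val + 1) (h : p.val + k ≤ m)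
    (N : Matrix (Fin n) (Fin m) Bool) :
    innerAction n m p q N = Matrix.of (setColBlock p N (evac (colBlock h N))) := by
  have huniq : ∃! ξ, (rowCrystal n m).IsIntervalSchutzenberger p q ξ :=
    existsUnique_isSchutzenberger_transport _ (existsUnique_isIntervalSchutzenberger hpq)
  exact congrFun (innerCactus_eq huniq
    ((isIntervalSchutzenberger_setColBlock_evac hk h).transport (rowTensor n m))) N

lemma outerAction_eq (hpq : p < q) (hk : p.val + (p.rev.val - q.rev.val + 1) = q.val + 1)
    (h : p.val + (p.rev.val - q.rev.val + 1) ≤ m) (N : Matrix (Fin n) (Fin m) Bool) :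
    outerAction n m q.rev p.rev N = Matrix.of (setColBlock p N (evac (colBlock h N))) := by
  ext r c
  simp only [outerAction, outerCactus, colTensor, Equiv.coe_fn_mk, Equiv.coe_fn_symm_mk,
    Matrix.of_apply, setColBlock]
  rw [schutzenberger_eq existsUnique_isFullSchutzenberger isFullSchutzenberger_evac]
  -- Reversing the order of the factors and each factor is the half turn of the rotated block, hence
  -- three quarter turns of the block itself.
  have hc : (fun j : Fin (p.rev.val - q.rev.val + 1) => (exteriorCrystal n).schutzenberger
      fun i => N i (Fin.rev ⟨p.rev.val - j.val, by omega⟩)) = rot (rot (rot (colBlock h N))) := by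
    funext j i
    rw [schutzenberger_exteriorCrystal]
    simp only [Function.comp_apply, rot, colBlock, Fin.rev_rev]
    congr 1
    ext
    have := j.2
    simp only [Fin.val_rev] at *
    omega
  rw [hc, evac_rot_rot_rot]
  have hcm := c.2
  by_cases hcp : p.val ≤ c.val ∧ c.val < p.val + (p.rev.val - q.rev.val + 1)
  · rw [dif_pos hcp, dif_pos (by simp only [Fin.val_rev] at *; omega)]
    simp only [rot]
    congr 1
    ext
    simp only [Fin.val_rev] at *
    omega
  · rw [dif_neg hcp, dif_neg (by simp only [Fin.val_rev] at *; omega), Fin.rev_rev]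

lemma card_eq_sum_wt (N : Matrix (Fin n) (Fin m) Bool) :
    ((univ.filter fun x : Fin n × Fin m => N x.1 x.2 = true).card : ℤ) =
      ∑ a, (rowCrystal n m).wt N a := by
  simp only [rowCrystal_eq_transport, GLCrystalData.transport, tensorPower, exteriorCrystal,
    Finset.sum_apply]
  rw [sum_comm, card_filter, ← Fintype.sum_prod_type']
  push_cast
  rfl

lemma intervalRev_involutive (p q : Fin m) : Function.Involutive (intervalRev p q) := by
  intro a
  by_cases h : p.val ≤ a.val ∧ a.val ≤ q.val
  · have e : intervalRev p q a = ⟨p.val + q.val - a.val, by omega⟩ := by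
      rw [intervalRev, dif_pos h]
    rw [e, intervalRev, dif_pos (by simp only; omega)]
    ext
    simp only
    omega
  · have e : intervalRev p q a = a := by rw [intervalRev, dif_neg h]
    rw [e, e]

/-- The number of ones is the sum of the weight coordinates, which the involution merely permutes.
-/
lemma map_mem_LambdaB_of_isIntervalSchutzenberger {K : ℕ}
    {ξ : Matrix (Fin n) (Fin m) Bool → Matrix (Fin n) (Fin m) Bool}
    (hξ : (rowCrystal n m).IsIntervalSchutzenberger p q ξ) {N : Matrix (Fin n) (Fin m) Bool}
    (hN : N ∈ LambdaB K n m) : ξ N ∈ LambdaB K n m := by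
  have h1 := card_eq_sum_wt N
  have h2 := card_eq_sum_wt (ξ N)
  simp only [hξ.wt_comm] at h2
  have hsum : ∑ a, (rowCrystal n m).wt N (intervalRev p q a) = ∑ a, (rowCrystal n m).wt N a :=
    Equiv.sum_comp (intervalRev_involutive p q).toPerm ((rowCrystal n m).wt N)
  rw [hsum, ← h1] at h2
  have h3 : (univ.filter fun x : Fin n × Fin m => N x.1 x.2 = true).card = K := hN
  rw [h3] at h2
  exact_mod_cast h2

end intervalInvolution

/-- The outer action of the cactus group on `0/1`-matrices agrees with the inner action. -/
theorem mainTheorem4 (n m K : ℕ) (p q : Fin m) (hpq : p < q) :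
    (∃! ξ, (exteriorCrystal n).IsFullSchutzenberger ξ) ∧
    (∃! ξ, ((exteriorCrystal n).tensorPower (q.val - p.val + 1)).IsFullSchutzenberger ξ) ∧
    (∃! ξ, (rowCrystal n m).IsIntervalSchutzenberger p q ξ) ∧
    ∀ N ∈ LambdaB K n m,
      outerAction n m q.rev p.rev N ∈ LambdaB K n m ∧
      outerAction n m q.rev p.rev N = innerAction n m p q N := by
  have hinner : ∃! ξ, (rowCrystal n m).IsIntervalSchutzenberger p q ξ :=
    GLCrystalData.existsUnique_isSchutzenberger_transport _
      (existsUnique_isIntervalSchutzenberger hpq)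
  refine ⟨existsUnique_isFullSchutzenberger_exteriorCrystal n, existsUnique_isFullSchutzenberger,
    hinner, fun N hN => ?_⟩
  have hk : p.val + (p.rev.val - q.rev.val + 1) = q.val + 1 := by
    have := q.2
    have : p.val < q.val := hpq
    simp only [Fin.val_rev]
    omega
  have h : p.val + (p.rev.val - q.rev.val + 1) ≤ m := by omega
  have heq : outerAction n m q.rev p.rev N = innerAction n m p q N := by
    rw [outerAction_eq hpq hk h, innerAction_eq hpq hk h]
  refine ⟨?_, heq⟩
  obtain ⟨ξ, hξ, _⟩ := id hinner
  rw [heq, innerAction, GLCrystalData.innerCactus_eq hinner hξ]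
  exact map_mem_LambdaB_of_isIntervalSchutzenberger hξ hN
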